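/- Let $\mathbb K$ be an uncountable algebraically closed field of characteristic zero. Let $X$ be a toral variety over $\mathbb K$, that is, an irreducible affine algebraic variety isomorphic to a closed subvariety of a torus $(\mathbb K^*)^d$ for some $d\ge 0$. Let $\mathrm{Aut}(X)$ be the group of regular automorphisms of $X$. An algebraic family of automorphisms of $X$ over an affine variety $B$ is a map $\varphi\colon B\to\mathrm{Aut}(X)$, $b\mapsto\varphi_b$, such that $(b,x)\mapsto\varphi_b(x)$ and $(b,x)\mapsto\varphi_b^{-1}(x)$ are morphisms $B\times X\to X$. Equip $\mathrm{Aut}(X)$ with its Zariski topology as an ind-group: a subset is closed if and only if its preimage under every algebraic family over an affine variety $B$ is Zariski closed in $B$. Let $\mathrm{Aut}^0(X)$ be the neutral component, i.e. the connected component of the identity; it is a normal subgroup. Then $\mathrm{Aut}(X)$ is a discrete extension of an algebraic torus, in the following sense. 1. $\mathrm{Aut}^0(X)$ is an algebraic torus of rank at most $\dim X$: there are an integer $s$ with $0\le s\le\dim X$ and a group isomorphism $\theta\colon(\mathbb K^*)^s\to\mathrm{Aut}^0(X)$ which is an isomorphism of algebraic groups, i.e. $\theta$ is an algebraic family of automorphisms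 of $X$, and for every algebraic family $\varphi\colon B\to\mathrm{Aut}(X)$ with values in $\mathrm{Aut}^0(X)$ the map $\theta^{-1}\circ\varphi\colon B\to(\mathbb K^*)^s$ is a morphism. 2. The quotient group $\mathrm{Aut}(X)/\mathrm{Aut}^0(X)$ is discrete: it is discrete in the quotient topology, and it is countable. In particular, every toral variety over $\mathbb K$ satisfies the conclusion of the Perepechko–Zaidenberg conjecture (for a rigid affine variety $Y$, the group $\mathrm{Aut}^0(Y)$ is an algebraic torus of rank at most $\dim Y$). -/

import Mathlib

universe u

/-- An affine algebraic variety over `K`, in the classical language of spaces with functions: a set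
of points with a finitely generated algebra of `K`-valued functions on it (the regular functions)
such that every `K`-algebra homomorphism from this algebra to `K` is the evaluation at exactly
one point. It may be reducible or empty. -/
structure AffineVariety (K : Type u) [Field K] where
  /-- The set of points. -/
  Point : Type u
  /-- The algebra `K[X]` of regular functions. -/
  regular : Subalgebra K (Point → K)
  fg : regular.FG
  eval_bijective : Function.Bijective
    (fun x : Point => ((Pi.evalAlgHom K (fun _ : Point => K) x).comp regular.val : regular →ₐ[K] K))

namespace AffineVariety

variable {K : Type u} [Field K]

/-- The Zariski topology: the sets `{x | f x ≠ 0}`, `f` regular, form a basis of open sets. -/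
instance zariskiTopology (X : AffineVariety K) : TopologicalSpace X.Point :=
  TopologicalSpace.generateFrom {U | ∃ f ∈ X.regular, U = {x | f x ≠ 0}}

/-- The dimension of `X`: the Krull dimension of `K[X]`. -/
noncomputable def dim (X : AffineVariety K) : WithBot ℕ∞ := ringKrullDim X.regular

/-- Morphisms of affine varieties: maps which pull regular functions back to regular ones. -/
def IsRegularMap (X Y : AffineVariety K) (φ : X.Point → Y.Point) : Prop :=
  ∀ f ∈ Y.regular, f ∘ φ ∈ X.regular

/-- `X` and `Y` are isomorphic affine varieties. -/
def IsIsomorphic (X Y : AffineVariety K) : Prop :=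
  ∃ e : X.Point ≃ Y.Point, IsRegularMap X Y e ∧ IsRegularMap Y X e.symm

/-- Pullback of functions along a map, as an algebra homomorphism. -/
def pullback {S T : Type u} (φ : S → T) : (T → K) →ₐ[K] (S → K) where
  toFun f := f ∘ φ
  map_one' := rfl
  map_mul' _ _ := rfl
  map_zero' := rfl
  map_add' _ _ := rfl
  commutes' _ := rfl

theorem regular_separates (X : AffineVariety K) {x y : X.Point}
    (h : ∀ f ∈ X.regular, f x = f y) : x = y :=
  X.eval_bijective.1 (AlgHom.ext fun f => h f.1 f.2)

theorem exists_point (X : AffineVariety K) (ψ : X.regular →ₐ[K] K) :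
    ∃ x : X.Point, ∀ f : X.regular, ψ f = f.1 x := by
  obtain ⟨x, hx⟩ := X.eval_bijective.2 ψ
  exact ⟨x, fun f => by rw [← hx]; rfl⟩

/-- The product variety: `K[X × Y]` is generated by the pullbacks of `K[X]` and `K[Y]`. -/
def prod (X Y : AffineVariety K) : AffineVariety K where
  Point := X.Point × Y.Point
  regular := X.regular.map (pullback Prod.fst) ⊔ Y.regular.map (pullback Prod.snd)
  fg := (X.fg.map _).sup (Y.fg.map _)
  eval_bijective := by
    constructor
    · rintro ⟨x, y⟩ ⟨x', y'⟩ h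
      have key : ∀ f ∈ X.regular.map (pullback Prod.fst) ⊔ Y.regular.map (pullback Prod.snd),
          f (x, y) = f (x', y') := fun f hf => DFunLike.congr_fun h ⟨f, hf⟩
      refine Prod.ext (X.regular_separates fun f hf => ?_) (Y.regular_separates fun f hf => ?_)
      · exact key _ ((le_sup_left : X.regular.map (pullback Prod.fst) ≤ _) ⟨f, hf, rfl⟩)
      · exact key _ ((le_sup_right : Y.regular.map (pullback Prod.snd) ≤ _) ⟨f, hf, rfl⟩)
    · intro ψ
      let R : Subalgebra K (X.Point × Y.Point → K) :=
        X.regular.map (pullback Prod.fst) ⊔ Y.regular.map (pullback Prod.snd)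
      have hl : X.regular.map (pullback Prod.fst) ≤ R := le_sup_left
      have hr : Y.regular.map (pullback Prod.snd) ≤ R := le_sup_right
      obtain ⟨x, hx⟩ := X.exists_point (ψ.comp
        (((pullback Prod.fst).comp X.regular.val).codRestrict R
          fun f => hl ⟨f.1, f.2, rfl⟩))
      obtain ⟨y, hy⟩ := Y.exists_point (ψ.comp
        (((pullback Prod.snd).comp Y.regular.val).codRestrict R
          fun f => hr ⟨f.1, f.2, rfl⟩))
      refine ⟨(x, y), AlgHom.ext fun f => ?_⟩
      let ev : R →ₐ[K] K := (Pi.evalAlgHom K (fun _ : X.Point × Y.Point => K) (x, y)).comp R.val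
      have hle : R ≤ (AlgHom.equalizer ev ψ).map R.val := by
        refine sup_le ?_ ?_
        · rintro _ ⟨f, hf, rfl⟩
          exact ⟨⟨_, hl ⟨f, hf, rfl⟩⟩, (hx ⟨f, hf⟩).symm, rfl⟩
        · rintro _ ⟨f, hf, rfl⟩
          exact ⟨⟨_, hr ⟨f, hf, rfl⟩⟩, (hy ⟨f, hf⟩).symm, rfl⟩
      obtain ⟨g, hg, hgf⟩ := hle f.2
      have : g = f := Subtype.ext hgf
      exact this ▸ hg

/-- The algebra of Laurent polynomial functions on the torus. -/
def torusRegular (K : Type u) [Field K] (d : ℕ) : Subalgebra K ((Fin d → Kˣ) → K) :=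
  Algebra.adjoin K (Set.range (fun (i : Fin d) (t : Fin d → Kˣ) => (t i : K)) ∪
    Set.range (fun (i : Fin d) (t : Fin d → Kˣ) => ((t i)⁻¹ : Kˣ).val))

/-- The torus `(Kˣ)^d`; its regular functions are the Laurent polynomials in the coordinates. -/
def torus (K : Type u) [Field K] (d : ℕ) : AffineVariety K where
  Point := Fin d → Kˣ
  regular := torusRegular K d
  fg := Subalgebra.fg_def.2 ⟨_, (Set.finite_range _).union (Set.finite_range _), rfl⟩
  eval_bijective := by
    have h1 : ∀ i : Fin d, (fun t : Fin d → Kˣ => (t i : K)) ∈ torusRegular K d :=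
      fun i => Algebra.subset_adjoin (Or.inl ⟨i, rfl⟩)
    have h2 : ∀ i : Fin d, (fun t : Fin d → Kˣ => ((t i)⁻¹ : Kˣ).val) ∈ torusRegular K d :=
      fun i => Algebra.subset_adjoin (Or.inr ⟨i, rfl⟩)
    constructor
    · intro s t h
      funext i
      refine Units.ext ?_
      exact DFunLike.congr_fun h (⟨_, h1 i⟩ : torusRegular K d)
    · intro ψ
      have hm : ∀ i, ψ ⟨_, h1 i⟩ * ψ ⟨_, h2 i⟩ = 1 := fun i => by
        rw [← map_mul, ← map_one ψ]
        congr 1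
        exact Subtype.ext (funext fun t => Units.mul_inv (t i))
      let t : Fin d → Kˣ := fun i =>
        ⟨ψ ⟨_, h1 i⟩, ψ ⟨_, h2 i⟩, hm i, by rw [mul_comm]; exact hm i⟩
      refine ⟨t, AlgHom.ext fun f => ?_⟩
      let ev : torusRegular K d →ₐ[K] K :=
        (Pi.evalAlgHom K (fun _ : Fin d → Kˣ => K) t).comp (torusRegular K d).val
      have hle : torusRegular K d ≤ (AlgHom.equalizer ev ψ).map (torusRegular K d).val := by
        refine Algebra.adjoin_le ?_
        rintro _ (⟨i, rfl⟩ | ⟨i, rfl⟩)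
        · exact ⟨⟨_, h1 i⟩, rfl, rfl⟩
        · exact ⟨⟨_, h2 i⟩, rfl, rfl⟩
      obtain ⟨g, hg, hgf⟩ := hle f.2
      have : g = f := Subtype.ext hgf
      exact this ▸ hg

/-- A Zariski closed set is the common zero set of the regular functions vanishing on it. -/
theorem mem_of_forall_vanishing (X : AffineVariety K) {Z : Set X.Point} (hZ : IsClosed Z)
    {x : X.Point} (hx : ∀ f ∈ X.regular, (∀ z ∈ Z, f z = 0) → f x = 0) : x ∈ Z := by
  have hgen : ∀ U : Set X.Point, IsOpen U → ∀ y ∈ U,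
      ∃ f ∈ X.regular, f y ≠ 0 ∧ ∀ z, f z ≠ 0 → z ∈ U := by
    intro U hU
    induction hU with
    | basic U hU =>
      obtain ⟨f, hf, rfl⟩ := hU
      exact fun y hy => ⟨f, hf, hy, fun z hz => hz⟩
    | univ => exact fun y _ => ⟨1, one_mem _, one_ne_zero, fun _ _ => trivial⟩
    | inter U V _ _ ihU ihV =>
      intro y hy
      obtain ⟨f, hf, hfy, hfU⟩ := ihU y hy.1
      obtain ⟨g, hg, hgy, hgV⟩ := ihV y hy.2
      exact ⟨f * g, mul_mem hf hg, mul_ne_zero hfy hgy,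
        fun z hz => ⟨hfU z (left_ne_zero_of_mul hz), hgV z (right_ne_zero_of_mul hz)⟩⟩
    | sUnion S _ ih =>
      rintro y ⟨U, hUS, hyU⟩
      obtain ⟨f, hf, hfy, hfU⟩ := ih U hUS y hyU
      exact ⟨f, hf, hfy, fun z hz => ⟨U, hUS, hfU z hz⟩⟩
  by_contra hxZ
  obtain ⟨f, hf, hfx, hfZ⟩ := hgen Zᶜ hZ.isOpen_compl x hxZ
  exact hfx (hx f hf fun z hz => by_contra fun hne => hfZ z hne hz)

/-- A Zariski closed subset as a variety: its regular functions are the restrictions of the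
regular functions of the ambient variety. -/
def closedSubvariety (X : AffineVariety K) (Z : Set X.Point) (hZ : IsClosed Z) :
    AffineVariety K where
  Point := Z
  regular := X.regular.map (pullback Subtype.val)
  fg := X.fg.map _
  eval_bijective := by
    constructor
    · intro x y h
      refine Subtype.ext (X.regular_separates fun f hf => ?_)
      exact DFunLike.congr_fun h (⟨_, ⟨f, hf, rfl⟩⟩ : X.regular.map (pullback Subtype.val))
    · intro ψ
      obtain ⟨x, hx⟩ := X.exists_point (ψ.comp
        (((pullback (Subtype.val : Z → X.Point)).comp X.regular.val).codRestrict
          (X.regular.map (pullback Subtype.val)) fun f => ⟨f.1, f.2, rfl⟩))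
      have hxZ : x ∈ Z := X.mem_of_forall_vanishing hZ fun f hf h0 => by
        refine (hx ⟨f, hf⟩).symm.trans (Eq.trans ?_ (map_zero ψ))
        exact congrArg ψ (Subtype.ext (funext fun z => h0 z.1 z.2))
      refine ⟨⟨x, hxZ⟩, AlgHom.ext ?_⟩
      rintro ⟨_, f, hf, rfl⟩
      exact (hx ⟨f, hf⟩).symm

/-- Toral varieties: irreducible affine varieties isomorphic to a closed subvariety of a torus. -/
def IsToral (X : AffineVariety K) : Prop :=
  IrreducibleSpace X.Point ∧
    ∃ (d : ℕ) (Z : Set (torus K d).Point) (hZ : IsClosed Z),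
      IsIsomorphic X ((torus K d).closedSubvariety Z hZ)

theorem IsRegularMap.id (X : AffineVariety K) : IsRegularMap X X (fun x => x) :=
  fun _ hf => hf

theorem IsRegularMap.comp {X Y Z : AffineVariety K} {ψ : Y.Point → Z.Point}
    {φ : X.Point → Y.Point} (hψ : IsRegularMap Y Z ψ) (hφ : IsRegularMap X Y φ) :
    IsRegularMap X Z (fun x => ψ (φ x)) :=
  fun f hf => hφ _ (hψ f hf)

/-- The regular automorphisms of `X`, as a subgroup of the group of bijections. -/
def autSubgroup (X : AffineVariety K) : Subgroup (Equiv.Perm X.Point) where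
  carrier := {σ | IsRegularMap X X (fun x => σ x) ∧ IsRegularMap X X (fun x => σ⁻¹ x)}
  one_mem' := ⟨IsRegularMap.id X, IsRegularMap.id X⟩
  mul_mem' := fun {σ τ} hσ hτ => by
    refine ⟨hσ.1.comp hτ.1, ?_⟩
    rw [mul_inv_rev]
    exact hτ.2.comp hσ.2
  inv_mem' := fun {σ} hσ => ⟨hσ.2, by rw [inv_inv]; exact hσ.1⟩

/-- The group `Aut(X)` of regular automorphisms of `X`, with composition. -/
def Aut (X : AffineVariety K) : Type u := X.autSubgroup

instance (X : AffineVariety K) : Group X.Aut := inferInstanceAs (Group X.autSubgroup)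

/-- The underlying map of an automorphism. -/
def Aut.map {X : AffineVariety K} (σ : X.Aut) : X.Point → X.Point := fun x => σ.1 x

/-- Algebraic families of automorphisms of `X` parametrized by a variety `B` (equivalently,
morphisms from `B` to the ind-group `Aut(X)`): the maps `(b, x) ↦ φ_b(x)` and
`(b, x) ↦ φ_b⁻¹(x)` are morphisms `B × X → X`. -/
def IsFamily {X : AffineVariety K} (B : AffineVariety K) (φ : B.Point → X.Aut) : Prop :=
  IsRegularMap (B.prod X) X (fun p => (φ p.1).map p.2) ∧
    IsRegularMap (B.prod X) X (fun p => (φ p.1)⁻¹.map p.2)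

/-- The (ind-)Zariski topology of `Aut(X)`: a subset is open (closed) if and only if its preimage
under every algebraic family of automorphisms is Zariski open (closed) in the base. -/
instance indTopology (X : AffineVariety K) : TopologicalSpace X.Aut :=
  ⨆ (B : AffineVariety K) (φ : B.Point → X.Aut) (_ : IsFamily B φ),
    TopologicalSpace.coinduced φ B.zariskiTopology

theorem isOpen_iff_forall_family {X : AffineVariety K} {U : Set X.Aut} :
    IsOpen U ↔ ∀ (B : AffineVariety K) (φ : B.Point → X.Aut), IsFamily B φ → IsOpen (φ ⁻¹' U) := by
  simp only [isOpen_iSup_iff, isOpen_coinduced]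

theorem continuous_of_family {X : AffineVariety K} (F : X.Aut → X.Aut)
    (hF : ∀ (B : AffineVariety K) (φ : B.Point → X.Aut), IsFamily B φ →
      IsFamily B (fun b => F (φ b))) : Continuous F :=
  ⟨fun _ hU => isOpen_iff_forall_family.2 fun B φ hφ =>
    isOpen_iff_forall_family.1 hU B _ (hF B φ hφ)⟩

theorem Aut.isRegularMap {X : AffineVariety K} (σ : X.Aut) : IsRegularMap X X σ.map := σ.2.1

theorem isRegularMap_fst (B X : AffineVariety K) :
    IsRegularMap (B.prod X) B (fun p => p.1) :=
  fun f hf => (le_sup_left : B.regular.map (pullback Prod.fst) ≤ _) ⟨f, hf, rfl⟩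

theorem isRegularMap_snd (B X : AffineVariety K) :
    IsRegularMap (B.prod X) X (fun p => p.2) :=
  fun f hf => (le_sup_right : X.regular.map (pullback Prod.snd) ≤ _) ⟨f, hf, rfl⟩

theorem IsRegularMap.prodMk {W Y Z : AffineVariety K} {φ : W.Point → Y.Point}
    {ψ : W.Point → Z.Point} (hφ : IsRegularMap W Y φ) (hψ : IsRegularMap W Z ψ) :
    IsRegularMap W (Y.prod Z) (fun w => (φ w, ψ w)) := by
  have hle : (Y.prod Z).regular ≤ W.regular.comap (pullback (fun w => (φ w, ψ w))) := by
    refine sup_le ?_ ?_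
    · rintro _ ⟨f, hf, rfl⟩
      exact hφ f hf
    · rintro _ ⟨f, hf, rfl⟩
      exact hψ f hf
  exact fun f hf => hle hf

theorem IsFamily.mul_left {X B : AffineVariety K} {φ : B.Point → X.Aut} (hφ : IsFamily B φ)
    (σ : X.Aut) : IsFamily B (fun b => σ * φ b) := by
  refine ⟨σ.isRegularMap.comp hφ.1, ?_⟩
  have h := hφ.2.comp ((isRegularMap_fst B X).prodMk (σ⁻¹.isRegularMap.comp (isRegularMap_snd B X)))
  simp only [mul_inv_rev]
  exact h

theorem IsFamily.mul_right {X B : AffineVariety K} {φ : B.Point → X.Aut} (hφ : IsFamily B φ)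
    (σ : X.Aut) : IsFamily B (fun b => φ b * σ) := by
  refine ⟨hφ.1.comp ((isRegularMap_fst B X).prodMk (σ.isRegularMap.comp (isRegularMap_snd B X))), ?_⟩
  simp only [mul_inv_rev]
  exact σ⁻¹.isRegularMap.comp hφ.2

/-- The neutral component `Aut⁰(X)`: the connected component of the identity in `Aut(X)`. -/
def neutralComponent (X : AffineVariety K) : Subgroup X.Aut where
  carrier := connectedComponent (1 : X.Aut)
  one_mem' := mem_connectedComponent
  mul_mem' := fun {a b} ha hb => by
    have hc : Continuous (fun x : X.Aut => a * x) :=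
      continuous_of_family _ fun B φ hφ => hφ.mul_left a
    have h := hc.mapsTo_connectedComponent (1 : X.Aut) hb
    rw [mul_one] at h
    rwa [connectedComponent_eq ha]
  inv_mem' := fun {a} ha => by
    have hc : Continuous (fun x : X.Aut => a⁻¹ * x) :=
      continuous_of_family _ fun B φ hφ => hφ.mul_left a⁻¹
    have h1 : (1 : X.Aut) ∈ connectedComponent a := by
      rw [← connectedComponent_eq ha]; exact mem_connectedComponent
    have h := hc.mapsTo_connectedComponent a h1
    simpa only [inv_mul_cancel, mul_one] using h

instance (X : AffineVariety K) : X.neutralComponent.Normal where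
  conj_mem := fun a ha g => by
    have hc : Continuous (fun x : X.Aut => g * x * g⁻¹) :=
      continuous_of_family _ fun B φ hφ => (hφ.mul_left g).mul_right g⁻¹
    have h := hc.mapsTo_connectedComponent (1 : X.Aut) ha
    rwa [mul_one, mul_inv_cancel] at h

/-- The subgroup `H` of the ind-group `Aut(X)` is an algebraic torus of rank `s`: there is a group
isomorphism `θ : (Kˣ)^s ≃ H` which is an isomorphism of varieties, that is, `θ` is an algebraic
family of automorphisms and, conversely, the composition of every algebraic family of
automorphisms with values in `H` with `θ⁻¹` is a morphism to the torus. -/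
def IsTorusOfRank {X : AffineVariety K} (H : Subgroup X.Aut) (s : ℕ) : Prop :=
  ∃ θ : (Fin s → Kˣ) ≃* H,
    IsFamily (torus K s) (fun t => (θ t : X.Aut)) ∧
    ∀ (B : AffineVariety K) (φ : B.Point → H), IsFamily B (fun b => (φ b : X.Aut)) →
      IsRegularMap B (torus K s) (fun b => θ.symm (φ b))

end AffineVariety

/-! The coordinates of the ambient torus restrict to units of `K[X]`, so `K[X]` is spanned by a
finitely generated group `M` of units. The key point is that units are rigid: modulo scalars, only
finitely many of them lie in a given finite-dimensional space and have their inverses in another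
(`exists_finset_scalar_of_mem_of_inv_mem`). Hence along an irreducible family of automorphisms the
pullback of a unit varies only by a scalar (`IsFamily.unit_comp_eq`). Once translated to pass
through the identity, such a family consists of diagonal automorphisms, each scaling the units in
`M` by a character `t` of `M`.

A character comes from a diagonal automorphism exactly when twisting by it preserves the linear
relations among the units. This happens exactly when it is trivial on the subgroup `L` generated by
the quotients of units occurring in a common relation of minimal support (`characterTwist_mem`,
`circuitSubgroup_le_ker`). So the diagonal group is `Hom(M/L, Kˣ)`, and `M/L` is `ℤ^s` times a
finite group. The factor `ℤ^s` gives a torus, which is connected. On the finite factor characters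
take values in roots of unity, so an irreducible family cannot vary there. Therefore the torus is
the neutral component and every union of its cosets is open (`inv_mul_mem_range_torusAction`,
`neutralComponent_eq`).

The rank is bounded by a chain of primes cut out by orbits of subtori (`rank_le_dim`). Countability
of the quotient holds because the units modulo scalars are countable, and an automorphism is
determined up to diagonal ones by where it sends generators of `M` modulo scalars. -/

/-! ### Finiteness of functions with bounded inverses. -/

/-- Modulo scalars, there are finitely many nonzero `f` in a finite-dimensional subspace of a
field extension whose inverses lie in a given finite-dimensional subspace. -/
theorem exists_finset_scalar_of_mem_of_inv_mem {K F : Type*} [Field K] [IsAlgClosed K] [Field F]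
    [Algebra K F] (V W : Submodule K F) [FiniteDimensional K V] [FiniteDimensional K W] :
    ∃ S : Finset F, (∀ h ∈ S, h ≠ 0 ∧ h ∈ V ∧ h⁻¹ ∈ W) ∧
      ∀ f : F, f ≠ 0 → f ∈ V → f⁻¹ ∈ W → ∃ h ∈ S, ∃ c : K, f = algebraMap K F c * h := by
  classical
  induction hn : Module.finrank K V + Module.finrank K W using Nat.strong_induction_on
    generalizing V W with
  | _ n ih =>
  by_cases hex : ∃ f : F, f ≠ 0 ∧ f ∈ V ∧ f⁻¹ ∈ W
  swap
  · exact ⟨∅, by simp, fun f hf hV hW => (hex ⟨f, hf, hV, hW⟩).elim⟩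
  obtain ⟨f₀, hf₀, hfV₀, hfW₀⟩ := hex
  by_cases hone : ∀ f : F, f ≠ 0 → f ∈ V → f⁻¹ ∈ W → ∃ c : K, f = algebraMap K F c * f₀
  · exact ⟨{f₀}, by simpa using ⟨hf₀, hfV₀, hfW₀⟩,
      fun f hf hV hW => ⟨f₀, by simp, hone f hf hV hW⟩⟩
  push Not at hone
  obtain ⟨f₁, hf₁, hfV₁, hfW₁, hne⟩ := hone
  let R : Subring F := (algebraMap K F).range
  have hR : f₁ / f₀ ∉ R := by
    rintro ⟨c, hc⟩
    exact hne c (by rw [hc, div_mul_cancel₀ _ hf₀])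
  -- An algebraically closed field is integrally closed in every extension, hence an intersection of
  -- valuation rings. One of these omits the nonconstant quotient `f₁ / f₀`.
  have : IsIntegrallyClosedIn R F := by
    rw [Subring.isIntegrallyClosedIn_iff]
    intro x hx
    have hx' : IsIntegral K x := by
      obtain ⟨p, hp, hpx⟩ := hx
      obtain ⟨q, hq, hdeg, hqm⟩ := Polynomial.lifts_and_degree_eq_and_monic
        (f := (algebraMap K F).rangeRestrict) (p := p)
        ((Polynomial.mem_lifts p).2
          (Polynomial.map_surjective _ (algebraMap K F).rangeRestrict_surjective p)) hp
      refine ⟨q, hqm, ?_⟩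
      rw [← hq, Polynomial.eval₂_map] at hpx
      exact hpx
    obtain ⟨c, hc⟩ := (IsAlgClosed.algebraMap_bijective_of_isIntegral
      (k := K) (K := integralClosure K F)).2 ⟨x, hx'⟩
    exact ⟨c, congrArg Subtype.val hc⟩
  obtain ⟨O, hRO, hO⟩ := Subring.exists_le_valuationSubring_of_isIntegrallyClosedIn hR
  have hKO : ∀ c : K, algebraMap K F c ∈ O := fun c => hRO ⟨c, rfl⟩
  -- `V'` omits `f₁` and `W'` omits `f₀⁻¹`, so both dimensions drop. Every `f` is covered by one of
  -- them: either `f / f₀ ∈ O`, or its inverse `f₀ * f⁻¹` has valuation less than one.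
  let V' : Submodule K F :=
    { carrier := {f | f ∈ V ∧ f / f₀ ∈ O}
      zero_mem' := ⟨zero_mem _, by rw [zero_div]; exact zero_mem _⟩
      add_mem' := fun ha hb => ⟨add_mem ha.1 hb.1, by rw [add_div]; exact add_mem ha.2 hb.2⟩
      smul_mem' := fun c a ha => ⟨V.smul_mem c ha.1, by
        rw [Algebra.smul_def, mul_div_assoc]; exact mul_mem (hKO c) ha.2⟩ }
  let W' : Submodule K F :=
    { carrier := {g | g ∈ W ∧ O.valuation (f₀ * g) < 1}
      zero_mem' := ⟨zero_mem _, by simp⟩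
      add_mem' := fun ha hb => ⟨add_mem ha.1 hb.1, by
        rw [mul_add]; exact Valuation.map_add_lt _ ha.2 hb.2⟩
      smul_mem' := fun c a ha => ⟨W.smul_mem c ha.1, by
        rw [Algebra.smul_def, mul_left_comm, map_mul]
        exact (mul_le_of_le_one_left' ((O.valuation_le_one_iff _).2 (hKO c))).trans_lt ha.2⟩ }
  have hV' : V' < V := lt_of_le_of_ne (fun f hf => hf.1) fun h =>
    hO (h.symm ▸ hfV₁ : f₁ ∈ V').2
  have hW' : W' < W := lt_of_le_of_ne (fun f hf => hf.1) fun h => by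
    have := (h.symm ▸ hfW₀ : f₀⁻¹ ∈ W').2
    rw [mul_inv_cancel₀ hf₀, map_one] at this
    exact lt_irrefl _ this
  have : FiniteDimensional K V' := Submodule.finiteDimensional_of_le hV'.le
  have : FiniteDimensional K W' := Submodule.finiteDimensional_of_le hW'.le
  have h1 := Submodule.finrank_lt_finrank_of_lt hV'
  have h2 := Submodule.finrank_lt_finrank_of_lt hW'
  obtain ⟨S₁, hS₁, h₁⟩ := ih _ (by omega) V' W rfl
  obtain ⟨S₂, hS₂, h₂⟩ := ih _ (by omega) V W' rfl
  refine ⟨S₁ ∪ S₂, fun h hh => (Finset.mem_union.1 hh).elim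
    (fun hh => ⟨(hS₁ h hh).1, (hS₁ h hh).2.1.1, (hS₁ h hh).2.2⟩)
    (fun hh => ⟨(hS₂ h hh).1, (hS₂ h hh).2.1, (hS₂ h hh).2.2.1⟩), fun f hf hV hW => ?_⟩
  by_cases hfO : f / f₀ ∈ O
  · obtain ⟨h, hh, hc⟩ := h₁ f hf ⟨hV, hfO⟩ hW
    exact ⟨h, Finset.mem_union_left _ hh, hc⟩
  · have : O.valuation (f₀ * f⁻¹) < 1 := by
      rw [← O.valuation_le_one_iff, not_le] at hfO
      rw [← div_eq_mul_inv, ← inv_div, map_inv₀]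
      exact inv_lt_one_of_one_lt₀ hfO
    obtain ⟨h, hh, hc⟩ := h₂ f hf hV ⟨hW, this⟩
    exact ⟨h, Finset.mem_union_right _ hh, hc⟩

/-! ### Irreducibility and Noetherianity in the Zariski topology. -/

namespace AffineVariety

variable {K : Type u} [Field K]

theorem isClosed_zeroLocus (X : AffineVariety K) {f : X.Point → K} (hf : f ∈ X.regular) :
    IsClosed {x | f x = 0} :=
  ⟨TopologicalSpace.isOpen_generateFrom_of_mem ⟨f, hf, rfl⟩⟩

theorem exists_basic_subset (X : AffineVariety K) {U : Set X.Point} (hU : IsOpen U) {x : X.Point}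
    (hx : x ∈ U) : ∃ f ∈ X.regular, f x ≠ 0 ∧ ∀ z, f z ≠ 0 → z ∈ U := by
  by_contra! h
  refine X.mem_of_forall_vanishing hU.isClosed_compl (x := x) (fun f hf h0 => ?_) hx
  by_contra hfx
  obtain ⟨z, hz, hzU⟩ := h f hf hfx
  exact hz (h0 z hzU)

theorem mul_eq_zero_of_irreducible (X : AffineVariety K) [IrreducibleSpace X.Point]
    {f g : X.Point → K} (hf : f ∈ X.regular) (hg : g ∈ X.regular) (h : f * g = 0) :
    f = 0 ∨ g = 0 := by
  have := isPreirreducible_iff_isClosed_union_isClosed.1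
    (IrreducibleSpace.isIrreducible_univ X.Point).isPreirreducible _ _
    (X.isClosed_zeroLocus hf) (X.isClosed_zeroLocus hg)
    (fun x _ => mul_eq_zero.1 (congrFun h x))
  exact this.imp (fun h => funext fun x => h trivial) (fun h => funext fun x => h trivial)

theorem isDomain_regular (X : AffineVariety K) [IrreducibleSpace X.Point] :
    IsDomain X.regular := by
  have : Nontrivial X.regular := ⟨0, 1, fun h => by
    obtain ⟨x⟩ := (inferInstance : Nonempty X.Point)
    exact zero_ne_one (congrFun (congrArg Subtype.val h) x)⟩
  have : NoZeroDivisors X.regular := ⟨fun {f g} h =>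
    (X.mul_eq_zero_of_irreducible f.2 g.2 (congrArg Subtype.val h)).imp Subtype.ext Subtype.ext⟩
  exact NoZeroDivisors.to_isDomain _

theorem irreducibleSpace_of_mul_eq_zero (X : AffineVariety K) [Nonempty X.Point]
    (h : ∀ f ∈ X.regular, ∀ g ∈ X.regular, f * g = 0 → f = 0 ∨ g = 0) :
    IrreducibleSpace X.Point where
  toNonempty := inferInstance
  isPreirreducible_univ := by
    rintro U V hU hV ⟨x, -, hx⟩ ⟨y, -, hy⟩
    obtain ⟨f, hf, hfx, hfU⟩ := X.exists_basic_subset hU hx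
    obtain ⟨g, hg, hgy, hgV⟩ := X.exists_basic_subset hV hy
    by_contra hne
    have h0 : f * g = 0 := by
      funext z
      by_contra hz
      exact hne ⟨z, trivial, hfU z (left_ne_zero_of_mul hz), hgV z (right_ne_zero_of_mul hz)⟩
    rcases h f hf g hg h0 with rfl | rfl
    · exact hfx rfl
    · exact hgy rfl

/-- A closed set is determined by the ideal of functions vanishing on it, so descending chains of
closed sets become ascending chains of ideals in a Noetherian ring. -/
instance noetherianSpace (X : AffineVariety K) : TopologicalSpace.NoetherianSpace X.Point := by
  have : Algebra.FiniteType K X.regular := X.regular.fg_iff_finiteType.1 X.fg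
  have : IsNoetherianRing X.regular := Algebra.FiniteType.isNoetherianRing K X.regular
  refine ((TopologicalSpace.noetherianSpace_TFAE X.Point).out 0 1 :
    _ ↔ WellFoundedLT (TopologicalSpace.Closeds X.Point)).2 ?_
  let J : TopologicalSpace.Closeds X.Point → Ideal X.regular := fun Z =>
    { carrier := {f | ∀ z ∈ Z, f.1 z = 0}
      zero_mem' := fun _ _ => rfl
      add_mem' := fun {a b} ha hb z hz => by
        change a.1 z + b.1 z = 0
        rw [ha z hz, hb z hz, add_zero]
      smul_mem' := fun c a ha z hz => by
        change c.1 z * a.1 z = 0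
        rw [ha z hz, mul_zero] }
  have hJ : StrictAnti J := by
    intro Z₁ Z₂ h
    refine lt_of_le_of_ne (fun f hf z hz => hf z (h.le hz)) fun heq => h.not_ge fun x hx => ?_
    refine X.mem_of_forall_vanishing Z₁.isClosed fun f hf h0 => ?_
    have : (⟨f, hf⟩ : X.regular) ∈ J Z₂ := by rw [heq]; exact h0
    exact this x hx
  exact hJ.wellFoundedLT

theorem exists_laurent_numerator {s : ℕ} {f : (Fin s → Kˣ) → K} (hf : f ∈ torusRegular K s) :
    ∃ (P : MvPolynomial (Fin s) K) (n : ℕ), ∀ t : Fin s → Kˣ,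
      MvPolynomial.eval (fun i => (t i : K)) P = f t * (∏ i, (t i : K)) ^ n := by
  induction hf using Algebra.adjoin_induction with
  | mem f hf =>
    rcases hf with ⟨i, rfl⟩ | ⟨i, rfl⟩
    · exact ⟨MvPolynomial.X i, 0, fun t => by simp⟩
    · classical
      refine ⟨∏ j ∈ Finset.univ.erase i, MvPolynomial.X j, 1, fun t => ?_⟩
      rw [pow_one, ← Finset.mul_prod_erase _ _ (Finset.mem_univ i), map_prod]
      simp
  | algebraMap c => exact ⟨MvPolynomial.C c, 0, fun t => by simp⟩
  | add f g _ _ ihf ihg =>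
    obtain ⟨P, n, hP⟩ := ihf
    obtain ⟨Q, m, hQ⟩ := ihg
    refine ⟨P * (∏ i, MvPolynomial.X i) ^ m + Q * (∏ i, MvPolynomial.X i) ^ n, n + m,
      fun t => ?_⟩
    simp only [map_add, map_mul, map_pow, map_prod, MvPolynomial.eval_X, hP, hQ, Pi.add_apply]
    ring
  | mul f g _ _ ihf ihg =>
    obtain ⟨P, n, hP⟩ := ihf
    obtain ⟨Q, m, hQ⟩ := ihg
    refine ⟨P * Q, n + m, fun t => ?_⟩
    simp only [map_mul, hP, hQ, Pi.mul_apply]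
    ring

instance irreducibleSpace_torus [Infinite K] (s : ℕ) : IrreducibleSpace (torus K s).Point := by
  have : Nonempty (torus K s).Point := ⟨fun _ => (1 : Kˣ)⟩
  refine irreducibleSpace_of_mul_eq_zero _ fun f hf g hg h => ?_
  obtain ⟨P, n, hP⟩ := exists_laurent_numerator hf
  obtain ⟨Q, m, hQ⟩ := exists_laurent_numerator hg
  -- The extra monomial forces vanishing where some coordinate is zero, so the polynomial is zero on
  -- all of `K^s` and not only on the torus.
  have key : (∏ i, MvPolynomial.X i) * (P * Q) = (0 : MvPolynomial (Fin s) K) := by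
    refine MvPolynomial.funext fun x => ?_
    by_cases hx : ∃ i, x i = 0
    · obtain ⟨i, hi⟩ := hx
      simp only [map_mul, map_prod, MvPolynomial.eval_X, map_zero]
      rw [Finset.prod_eq_zero (Finset.mem_univ i) hi, zero_mul]
    · push Not at hx
      let t : Fin s → Kˣ := fun i => Units.mk0 (x i) (hx i)
      have h1 := hP t
      have h2 := hQ t
      have h3 : f t * g t = 0 := congrFun h t
      simp only [map_mul, map_prod, MvPolynomial.eval_X, map_zero]
      change _ * (MvPolynomial.eval (fun i => (t i : K)) P *
        MvPolynomial.eval (fun i => (t i : K)) Q) = 0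
      rw [h1, h2, mul_mul_mul_comm, h3]
      ring
  have aux : ∀ (f : (Fin s → Kˣ) → K) (P : MvPolynomial (Fin s) K) (n : ℕ), (∀ t : Fin s → Kˣ,
      MvPolynomial.eval (fun i => (t i : K)) P = f t * (∏ i, (t i : K)) ^ n) → P = 0 → f = 0 := by
    intro f P n hP h0
    funext t
    have := hP t
    rw [h0, map_zero] at this
    refine (mul_eq_zero.1 this.symm).resolve_right (pow_ne_zero _ ?_)
    exact Finset.prod_ne_zero_iff.2 fun i _ => (t i).ne_zero
  rcases mul_eq_zero.1 key with h0 | h0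
  · exact absurd h0 (Finset.prod_ne_zero_iff.2 fun i _ => MvPolynomial.X_ne_zero i)
  · exact (mul_eq_zero.1 h0).imp (aux f P n hP) (aux g Q m hQ)

end AffineVariety

/-! ### Units of `K[X]` modulo scalars, and their rigidity in families. -/

namespace AffineVariety

variable {K : Type u} [Field K]

/-- The finiteness is applied in the function field. The representatives found there are units of
`K[X]`, since they and their inverses lie in the images of `V` and `W`. -/
theorem exists_finset_units [IsAlgClosed K] (X : AffineVariety K) [IrreducibleSpace X.Point]
    {V W : Submodule K X.regular} (hV : V.FG) (hW : W.FG) :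
    ∃ S : Finset X.regularˣ, ∀ u : X.regularˣ, (u : X.regular) ∈ V → (↑u⁻¹ : X.regular) ∈ W →
      ∃ h ∈ S, ∃ c : K, (u : X.regular) = c • (h : X.regular) := by
  classical
  have := X.isDomain_regular
  let F := FractionRing X.regular
  let ι : X.regular →ₐ[K] F := IsScalarTower.toAlgHom K X.regular F
  have hι : Function.Injective ι := IsFractionRing.injective X.regular F
  have : FiniteDimensional K (V.map ι.toLinearMap) := Module.Finite.iff_fg.2 (hV.map _)
  have : FiniteDimensional K (W.map ι.toLinearMap) := Module.Finite.iff_fg.2 (hW.map _)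
  obtain ⟨S, hS, hS'⟩ :=
    exists_finset_scalar_of_mem_of_inv_mem (V.map ι.toLinearMap) (W.map ι.toLinearMap)
  have hunit : ∀ h : S, ∃ v : X.regularˣ, ι v = h.1 := by
    intro h
    obtain ⟨h0, ⟨a, -, ha⟩, ⟨b, -, hb⟩⟩ := hS h.1 h.2
    have hab : a * b = 1 := hι (by
      rw [map_mul, map_one]
      exact (congrArg₂ _ ha hb).trans (mul_inv_cancel₀ h0))
    exact ⟨⟨a, b, hab, by rw [mul_comm, hab]⟩, ha⟩
  choose v hv using hunit
  refine ⟨Finset.univ.image v, fun u hu hu' => ?_⟩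
  have hinv : ι (↑u⁻¹ : X.regular) = (ι u)⁻¹ := by
    refine eq_inv_of_mul_eq_one_left ?_
    rw [← map_mul, Units.inv_mul, map_one]
  obtain ⟨h, hh, c, hc⟩ := hS' (ι u) (u.isUnit.map ι).ne_zero ⟨u, hu, rfl⟩
    (hinv ▸ ⟨_, hu', rfl⟩)
  refine ⟨v ⟨h, hh⟩, Finset.mem_image_of_mem _ (Finset.mem_univ _), c, hι ?_⟩
  rw [hc, map_smul, hv, Algebra.smul_def]

/-- The group of units of `K[X]` modulo scalars is countable. -/
theorem exists_countable_units [IsAlgClosed K] (X : AffineVariety K) [IrreducibleSpace X.Point] :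
    ∃ S : Set X.regularˣ, S.Countable ∧ ∀ u : X.regularˣ,
      ∃ h ∈ S, ∃ c : K, (u : X.regular) = c • (h : X.regular) := by
  have hft : Algebra.FiniteType K X.regular := X.regular.fg_iff_finiteType.1 X.fg
  obtain ⟨s, π, hπ⟩ := Algebra.FiniteType.iff_quotient_mvPolynomial''.1 hft
  -- Images of the polynomials of total degree at most `n`: these finite-dimensional spaces exhaust
  -- `K[X]`.
  let V : ℕ → Submodule K X.regular := fun n =>
    (MvPolynomial.restrictTotalDegree (Fin s) K n).map π.toLinearMap
  have hV : ∀ n, (V n).FG := fun n => Submodule.FG.map _ (Module.Finite.iff_fg.1 inferInstance)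
  choose S hS using fun n => X.exists_finset_units (hV n) (hV n)
  refine ⟨⋃ n, (S n : Set X.regularˣ), Set.countable_iUnion fun n => (S n).countable_toSet,
    fun u => ?_⟩
  obtain ⟨p, hp⟩ := hπ u
  obtain ⟨q, hq⟩ := hπ (↑u⁻¹ : X.regular)
  obtain ⟨h, hh, hc⟩ := hS (max p.totalDegree q.totalDegree) u
    ⟨p, (MvPolynomial.mem_restrictTotalDegree _ _ _).2 (le_max_left _ _), hp⟩
    ⟨q, (MvPolynomial.mem_restrictTotalDegree _ _ _).2 (le_max_right _ _), hq⟩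
  exact ⟨h, Set.mem_iUnion.2 ⟨_, hh⟩, hc⟩

theorem isRegularMap_const (B X : AffineVariety K) (x : X.Point) :
    IsRegularMap B X (fun _ => x) :=
  fun f _ => B.regular.algebraMap_mem (f x)

/-- A regular function on the product is a finite sum of terms `f(b) g(x)`, so all its slices lie in
the span of the finitely many `g`. The functions with this property form a subalgebra containing
both sets of generators. -/
theorem exists_fg_slices (B X : AffineVariety K) {F : B.Point × X.Point → K}
    (hF : F ∈ (B.prod X).regular) :
    ∃ V : Submodule K X.regular, V.FG ∧ ∀ b, ∃ h ∈ V, ∀ x, h.1 x = F (b, x) := by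
  let R : Subalgebra K (B.Point × X.Point → K) :=
    { carrier := {F | ∃ V : Submodule K X.regular, V.FG ∧ ∀ b, ∃ h ∈ V, ∀ x, h.1 x = F (b, x)}
      mul_mem' := by
        rintro F G ⟨V, hV, h⟩ ⟨W, hW, k⟩
        refine ⟨V * W, hV.mul hW, fun b => ?_⟩
        obtain ⟨f, hf, hfx⟩ := h b
        obtain ⟨g, hg, hgx⟩ := k b
        exact ⟨f * g, Submodule.mul_mem_mul hf hg, fun x => congrArg₂ _ (hfx x) (hgx x)⟩
      add_mem' := by
        rintro F G ⟨V, hV, h⟩ ⟨W, hW, k⟩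
        refine ⟨V ⊔ W, hV.sup hW, fun b => ?_⟩
        obtain ⟨f, hf, hfx⟩ := h b
        obtain ⟨g, hg, hgx⟩ := k b
        exact ⟨f + g, Submodule.add_mem_sup hf hg, fun x => congrArg₂ _ (hfx x) (hgx x)⟩
      algebraMap_mem' := fun c => ⟨K ∙ 1, Submodule.fg_span_singleton _, fun b =>
        ⟨algebraMap K _ c, Submodule.mem_span_singleton.2 ⟨c, (Algebra.algebraMap_eq_smul_one c).symm⟩,
          fun _ => rfl⟩⟩ }
  have hR : (B.prod X).regular ≤ R := by
    refine sup_le ?_ ?_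
    · rintro _ ⟨f, hf, rfl⟩
      exact ⟨K ∙ 1, Submodule.fg_span_singleton _, fun b => ⟨algebraMap K _ (f b),
        Submodule.mem_span_singleton.2 ⟨f b, (Algebra.algebraMap_eq_smul_one _).symm⟩,
        fun _ => rfl⟩⟩
    · rintro _ ⟨f, hf, rfl⟩
      exact ⟨K ∙ ⟨f, hf⟩, Submodule.fg_span_singleton _, fun b =>
        ⟨⟨f, hf⟩, Submodule.mem_span_singleton_self _, fun _ => rfl⟩⟩
  exact hR hF

theorem units_apply_ne_zero {X : AffineVariety K} (u : X.regularˣ) (x : X.Point) :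
    (u : X.regular).1 x ≠ 0 := by
  intro h
  have := congrFun (congrArg Subtype.val u.mul_inv) x
  change (u : X.regular).1 x * _ = 1 at this
  rw [h, zero_mul] at this
  exact zero_ne_one this

theorem IsFamily.orbit {X B : AffineVariety K} {φ : B.Point → X.Aut} (hφ : IsFamily B φ)
    (x : X.Point) : IsRegularMap B X (fun b => (φ b).map x) :=
  hφ.1.comp ((IsRegularMap.id B).prodMk (isRegularMap_const B X x))

/-- In an irreducible family of automorphisms, the pullbacks of a unit are proportional. -/
theorem IsFamily.unit_comp_eq [IsAlgClosed K] {X B : AffineVariety K} [IrreducibleSpace X.Point]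
    {φ : B.Point → X.Aut} (hφ : IsFamily B φ) {Z : Set B.Point} (hZ : IsIrreducible Z)
    {b₀ b : B.Point} (hb₀ : b₀ ∈ Z) (hb : b ∈ Z) (u : X.regularˣ) :
    ∃ c : K, ∀ x, (u : X.regular).1 ((φ b).map x) = c * (u : X.regular).1 ((φ b₀).map x) := by
  classical
  let f : B.Point → X.regularˣ := fun b =>
    ⟨⟨_, (φ b).isRegularMap _ (u : X.regular).2⟩, ⟨_, (φ b).isRegularMap _ (↑u⁻¹ : X.regular).2⟩,
      Subtype.ext (funext fun x => congrFun (congrArg Subtype.val u.mul_inv) ((φ b).map x)),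
      Subtype.ext (funext fun x => congrFun (congrArg Subtype.val u.inv_mul) ((φ b).map x))⟩
  obtain ⟨V, hV, hVf⟩ := exists_fg_slices B X (hφ.1 _ (u : X.regular).2)
  obtain ⟨W, hW, hWf⟩ := exists_fg_slices B X (hφ.1 _ (↑u⁻¹ : X.regular).2)
  obtain ⟨S, hS⟩ := X.exists_finset_units hV hW
  have hfS : ∀ b, ∃ h ∈ S, ∃ c : K, (f b : X.regular) = c • (h : X.regular) := by
    intro b
    obtain ⟨h, hh, hx⟩ := hVf b
    obtain ⟨k, hk, kx⟩ := hWf b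
    refine hS (f b) ?_ ?_
    · convert! hh
      exact Subtype.ext (funext fun x => (hx x).symm)
    · convert! hk
      exact Subtype.ext (funext fun x => (kx x).symm)
  -- The parameters where the pullback of `u` is proportional to `h`. Cross-multiplication makes
  -- this a closed condition on `b`. Finitely many such sets cover `Z`, so by irreducibility a
  -- single one does.
  let C : X.regularˣ → Set B.Point := fun h => {b | ∀ x x' : X.Point,
    (u : X.regular).1 ((φ b).map x) * (h : X.regular).1 x' -
      (u : X.regular).1 ((φ b).map x') * (h : X.regular).1 x = 0}
  have hC : ∀ h, IsClosed (C h) := by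
    intro h
    have : C h = ⋂ (x : X.Point) (x' : X.Point), {b | (u : X.regular).1 ((φ b).map x) *
        (h : X.regular).1 x' - (u : X.regular).1 ((φ b).map x') * (h : X.regular).1 x = 0} := by
      ext b
      simp only [C, Set.mem_ofPred_eq, Set.mem_iInter]
    rw [this]
    refine isClosed_iInter fun x => isClosed_iInter fun x' => B.isClosed_zeroLocus (sub_mem ?_ ?_)
    · exact mul_mem (hφ.orbit x _ (u : X.regular).2) (B.regular.algebraMap_mem _)
    · exact mul_mem (hφ.orbit x' _ (u : X.regular).2) (B.regular.algebraMap_mem _)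
  obtain ⟨_, hD, hZD⟩ := (isIrreducible_iff_sUnion_isClosed.1 hZ) (S.image C)
    (fun D hD => by
      obtain ⟨h, -, rfl⟩ := Finset.mem_image.1 hD
      exact hC h)
    (fun b _ => by
      obtain ⟨h, hh, c, hc⟩ := hfS b
      refine ⟨C h, by simpa using ⟨h, hh, rfl⟩, fun x x' => ?_⟩
      have hc' : ∀ x, (u : X.regular).1 ((φ b).map x) = c * (h : X.regular).1 x :=
        fun x => congrFun (congrArg Subtype.val hc) x
      rw [hc', hc']
      ring)
  obtain ⟨h, -, rfl⟩ := Finset.mem_image.1 hD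
  obtain ⟨x₀⟩ := (inferInstance : Nonempty X.Point)
  have h₀ := units_apply_ne_zero u ((φ b₀).map x₀)
  refine ⟨(u : X.regular).1 ((φ b).map x₀) / (u : X.regular).1 ((φ b₀).map x₀), fun x => ?_⟩
  have e1 := hZD hb x x₀
  have e2 := hZD hb₀ x x₀
  have h1 := units_apply_ne_zero h x₀
  rw [sub_eq_zero] at e1 e2
  rw [div_mul_eq_mul_div, eq_div_iff h₀]
  refine mul_right_cancel₀ h1 ?_
  linear_combination (u : X.regular).1 ((φ b₀).map x₀) * e1 -
    (u : X.regular).1 ((φ b).map x₀) * e2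

end AffineVariety

/-! ### Characters preserving a space of linear relations. -/

/-- The subgroup generated by the quotients of the elements of the supports of the nonzero
relations with minimal support, in a space `I` of relations. -/
def circuitSubgroup {K M : Type*} [Field K] [CommGroup M] (I : Submodule K (M →₀ K)) :
    Subgroup M :=
  Subgroup.closure {l | ∃ f ∈ I, (∀ g ∈ I, g.support ⊂ f.support → g = 0) ∧
    ∃ m ∈ f.support, ∃ m' ∈ f.support, l = m / m'}

/-- The action of a character on finitely supported functions. -/
noncomputable def characterTwist {K M : Type*} [Field K] [CommGroup M] (t : M →* Kˣ) :
    (M →₀ K) →ₗ[K] (M →₀ K) :=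
  Finsupp.lsum K fun m => (t m : K) • Finsupp.lsingle m

section Circuit

variable {K M : Type*} [Field K] [CommGroup M] {I : Submodule K (M →₀ K)} {t : M →* Kˣ}

theorem characterTwist_apply (f : M →₀ K) (m : M) : characterTwist t f m = t m * f m := by
  classical
  induction f using Finsupp.induction_linear with
  | zero => simp
  | add f g hf hg => rw [map_add, Finsupp.add_apply, hf, hg, Finsupp.add_apply, mul_add]
  | single a b =>
    rw [characterTwist, Finsupp.lsum_single, LinearMap.smul_apply, Finsupp.lsingle_apply,
      Finsupp.smul_apply, Finsupp.single_apply]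
    split_ifs with h
    · rw [h, smul_eq_mul]
    · simp

/-- Relations of minimal support generate all of them, by induction on the size of the support. On a
minimal support `t` is constant, so the twist is a mere rescaling; any other relation splits into
two of smaller support. -/
theorem characterTwist_mem (ht : circuitSubgroup I ≤ t.ker) {f : M →₀ K} (hf : f ∈ I) :
    characterTwist t f ∈ I := by
  classical
  induction hn : f.support.card using Nat.strong_induction_on generalizing f with
  | _ n ih =>
  subst hn
  by_cases hmin : ∀ g ∈ I, g.support ⊂ f.support → g = 0
  · rcases f.support.eq_empty_or_nonempty with h0 | ⟨m₀, hm₀⟩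
    · rw [Finsupp.support_eq_empty.1 h0, map_zero]
      exact zero_mem _
    · have : characterTwist t f = (t m₀ : K) • f := by
        ext m
        rw [characterTwist_apply, Finsupp.smul_apply, smul_eq_mul]
        by_cases hm : m ∈ f.support
        · have h1 : m / m₀ ∈ t.ker :=
            ht (Subgroup.subset_closure ⟨f, hf, hmin, m, hm, m₀, hm₀, rfl⟩)
          rw [MonoidHom.mem_ker, map_div, div_eq_one] at h1
          rw [h1]
        · rw [Finsupp.notMem_support_iff.1 hm, mul_zero, mul_zero]
      rw [this]
      exact I.smul_mem _ hf
  · push Not at hmin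
    obtain ⟨g, hg, hgf, hg0⟩ := hmin
    obtain ⟨m, hm⟩ := Finsupp.support_nonempty_iff.2 hg0
    have hgm : g m ≠ 0 := Finsupp.mem_support_iff.1 hm
    let c := f m / g m
    have hf' : f - c • g ∈ I := sub_mem hf (I.smul_mem _ hg)
    have hsub : (f - c • g).support ⊂ f.support := by
      refine (Finset.ssubset_iff_of_subset fun k hk => ?_).2 ⟨m, hgf.1 hm, ?_⟩
      · by_contra hkf
        have h1 := Finsupp.notMem_support_iff.1 hkf
        have h2 := Finsupp.notMem_support_iff.1 fun h => hkf (hgf.1 h)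
        rw [Finsupp.mem_support_iff, Finsupp.sub_apply, Finsupp.smul_apply, h1, h2] at hk
        simp at hk
      · rw [Finsupp.notMem_support_iff, Finsupp.sub_apply, Finsupp.smul_apply, smul_eq_mul,
          div_mul_cancel₀ _ hgm, sub_self]
    have e : f = (f - c • g) + c • g := by rw [sub_add_cancel]
    rw [e, map_add, map_smul]
    exact add_mem (ih _ (Finset.card_lt_card hsub) hf' rfl)
      (I.smul_mem _ (ih _ (Finset.card_lt_card hgf) hg rfl))

/-- For `f` of minimal support, subtracting `t m • f` from the twist of `f` removes `m` from the
support. The difference is then zero, which forces `t` to be constant on the support. -/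
theorem circuitSubgroup_le_ker (ht : ∀ f ∈ I, characterTwist t f ∈ I) :
    circuitSubgroup I ≤ t.ker := by
  classical
  refine (Subgroup.closure_le _).2 ?_
  rintro _ ⟨f, hf, hmin, m, hm, m', hm', rfl⟩
  let g := characterTwist t f - (t m : K) • f
  have happ : ∀ k, g k = (t k - t m : K) * f k := fun k => by
    rw [Finsupp.sub_apply, characterTwist_apply, Finsupp.smul_apply, smul_eq_mul, sub_mul]
  have hg : g = 0 := by
    refine hmin g (sub_mem (ht f hf) (I.smul_mem _ hf)) ?_
    refine (Finset.ssubset_iff_of_subset fun k hk => ?_).2 ⟨m, hm, ?_⟩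
    · rw [Finsupp.mem_support_iff, happ] at hk
      exact Finsupp.mem_support_iff.2 (right_ne_zero_of_mul hk)
    · rw [Finsupp.notMem_support_iff, happ, sub_self, zero_mul]
  have h1 := happ m'
  rw [hg, Finsupp.zero_apply] at h1
  have h2 := (mul_eq_zero.1 h1.symm).resolve_right (Finsupp.mem_support_iff.1 hm')
  change t (m / m') = 1
  rw [map_div, div_eq_one]
  exact Units.ext (sub_eq_zero.1 h2).symm

end Circuit

/-! ### Diagonal automorphisms and their characters. -/

namespace AffineVariety

variable {K : Type u} [Field K] {X : AffineVariety K} {M : Type*} [CommGroup M]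
  (χ : M →* X.regularˣ)

/-- Evaluation at a point of a group of units of `K[X]`. -/
def unitEval (x : X.Point) : M →* Kˣ :=
  (Units.map ((Pi.evalAlgHom K (fun _ : X.Point => K) x).comp X.regular.val : X.regular →* K)).comp χ

theorem unitEval_apply (x : X.Point) (m : M) : (unitEval χ x m : K) = (χ m : X.regular).1 x := rfl

/-- The units in a group span the algebra of regular functions. -/
def Spans : Prop := Submodule.span K (Set.range fun m => (χ m : X.regular)) = ⊤

/-- The linear relations among the units in a group. -/
noncomputable def unitRelations : Submodule K (M →₀ K) :=
  LinearMap.ker (Finsupp.linearCombination K fun m => (χ m : X.regular))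

/-- The automorphism `σ` multiplies the units in the group by the values of the character `t`. -/
def IsDiagonal (σ : X.Aut) (t : M →* Kˣ) : Prop :=
  ∀ x m, unitEval χ (σ.map x) m = t m * unitEval χ x m

variable {χ}

theorem linearCombination_apply_point (f : M →₀ K) (x : X.Point) :
    (Finsupp.linearCombination K (fun m => (χ m : X.regular)) f).1 x =
      f.sum fun m a => a * unitEval χ x m := by
  have := map_finsuppSum ((Pi.evalAlgHom K (fun _ : X.Point => K) x).comp X.regular.val) f
    (fun m a => a • (χ m : X.regular))
  exact this

theorem mem_unitRelations {f : M →₀ K} :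
    f ∈ unitRelations χ ↔ ∀ x, (f.sum fun m a => a * (unitEval χ x m : K)) = 0 := by
  simp only [← linearCombination_apply_point]
  exact ⟨fun h x => congrFun (congrArg Subtype.val (LinearMap.mem_ker.1 h)) x,
    fun h => LinearMap.mem_ker.2 (Subtype.ext (funext h))⟩

theorem sum_characterTwist (f : M →₀ K) (t : M →* Kˣ) (v : M → K) :
    ((characterTwist t f).sum fun m a => a * v m) = f.sum fun m a => a * (t m * v m) := by
  classical
  induction f using Finsupp.induction_linear with
  | zero => simp
  | add f g hf hg =>
    rw [map_add, Finsupp.sum_add_index' (by simp) (by intros; ring), hf, hg,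
      Finsupp.sum_add_index' (by simp) (by intros; ring)]
  | single a b =>
    rw [characterTwist, Finsupp.lsum_single, LinearMap.smul_apply, Finsupp.lsingle_apply,
      Finsupp.smul_single, Finsupp.sum_single_index (by simp), Finsupp.sum_single_index (by simp),
      smul_eq_mul]
    ring

/-- A relation evaluated at `σ x` is the twisted relation evaluated at `x`, so `t` preserves the
relations. -/
theorem IsDiagonal.circuitSubgroup_le {σ : X.Aut} {t : M →* Kˣ} (h : IsDiagonal χ σ t) :
    circuitSubgroup (unitRelations χ) ≤ t.ker := by
  refine circuitSubgroup_le_ker fun f hf => mem_unitRelations.2 fun x => ?_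
  rw [sum_characterTwist]
  have := mem_unitRelations.1 hf (σ.map x)
  simpa [h x] using this

theorem Spans.regular_induction (hχ : Spans χ) {p : (X.Point → K) → Prop}
    (unit : ∀ m, p (χ m : X.regular).1) (zero : p 0) (add : ∀ f g, p f → p g → p (f + g))
    (smul : ∀ (c : K) f, p f → p (c • f)) {f : X.Point → K} (hf : f ∈ X.regular) : p f := by
  have h : (⟨f, hf⟩ : X.regular) ∈ Submodule.span K (Set.range fun m => (χ m : X.regular)) := by
    rw [hχ]; trivial
  refine Submodule.span_induction (p := fun g _ => p g.1) ?_ zero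
    (fun f g _ _ => add f.1 g.1) (fun c f _ => smul c f.1) h
  rintro _ ⟨m, rfl⟩
  exact unit m

theorem Spans.unitEval_injective (hχ : Spans χ) : Function.Injective (unitEval χ) := by
  intro x y h
  refine X.regular_separates fun f hf => ?_
  refine hχ.regular_induction (p := fun f => f x = f y) (fun m => ?_) rfl ?_ ?_ hf
  · rw [← unitEval_apply, ← unitEval_apply, h]
  · intro f g hf hg
    rw [Pi.add_apply, Pi.add_apply, hf, hg]
  · intro c f hf
    rw [Pi.smul_apply, Pi.smul_apply, hf]

/-- Points are algebra homomorphisms to `K`, and `K[X]` is the quotient of the group algebra of `M`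
by the relations. The homomorphism sending `m` to `t m` times its value at `x` kills the relations
because twisting by `t` preserves them, so it descends to a point. -/
theorem Spans.exists_translate (hχ : Spans χ) {t : M →* Kˣ}
    (ht : circuitSubgroup (unitRelations χ) ≤ t.ker) (x : X.Point) :
    ∃ y, ∀ m, unitEval χ y m = t m * unitEval χ x m := by
  classical
  let χ' : M →* X.regular := (Units.coeHom _).comp χ
  let π : MonoidAlgebra K M →ₐ[K] X.regular := MonoidAlgebra.lift K X.regular M χ'
  let ψ : MonoidAlgebra K M →ₐ[K] K :=
    MonoidAlgebra.lift K K M ((Units.coeHom K).comp (t * unitEval χ x))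
  have hπs : ∀ m, π (MonoidAlgebra.single m 1) = χ' m := fun m => by
    simp [π]
  have hψs : ∀ m, ψ (MonoidAlgebra.single m 1) = t m * unitEval χ x m := fun m => by
    simp [ψ]
  have hπ : Function.Surjective π := by
    rw [← AlgHom.coe_toLinearMap, ← LinearMap.range_eq_top, ← top_le_iff, ← hχ,
      Submodule.span_le]
    rintro _ ⟨m, rfl⟩
    exact ⟨MonoidAlgebra.single m 1, hπs m⟩
  have hker : RingHom.ker π.toRingHom ≤ RingHom.ker ψ.toRingHom := by
    intro a (ha : π a = 0)
    have ha' : a.coeff ∈ unitRelations χ := by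
      refine mem_unitRelations.2 fun y => ?_
      have := congrFun (congrArg Subtype.val ha) y
      rw [← linearCombination_apply_point]
      refine Eq.trans ?_ this
      rw [MonoidAlgebra.lift_apply]
      rfl
    have h2 := mem_unitRelations.1 (characterTwist_mem ht ha') x
    rw [sum_characterTwist] at h2
    change ψ a = 0
    rw [MonoidAlgebra.lift_apply]
    refine Eq.trans ?_ h2
    simp [Finsupp.sum]
  obtain ⟨y, hy⟩ := X.exists_point (AlgHom.liftOfSurjective π hπ ψ hker)
  refine ⟨y, fun m => Units.ext ?_⟩
  rw [unitEval_apply, ← hy (χ m)]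
  have h1 : (χ m : X.regular) = π (MonoidAlgebra.single m 1) := (hπs m).symm
  rw [h1, AlgHom.liftOfSurjective_apply, hψs]
  rfl

theorem Spans.exists_isDiagonal (hχ : Spans χ) {t : M →* Kˣ}
    (ht : circuitSubgroup (unitRelations χ) ≤ t.ker) : ∃ σ : X.Aut, IsDiagonal χ σ t := by
  have ht' : circuitSubgroup (unitRelations χ) ≤ (t⁻¹).ker := fun m hm => by
    rw [MonoidHom.mem_ker, MonoidHom.inv_apply, MonoidHom.mem_ker.1 (ht hm), inv_one]
  choose F hF using hχ.exists_translate ht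
  choose G hG using hχ.exists_translate ht'
  have reg : ∀ (t : M →* Kˣ) (F : X.Point → X.Point),
      (∀ x m, unitEval χ (F x) m = t m * unitEval χ x m) → IsRegularMap X X F := by
    intro t F hF f hf
    refine hχ.regular_induction (p := fun f => f ∘ F ∈ X.regular) (fun m => ?_) (zero_mem _)
      (fun _ _ => add_mem) (fun c _ h => X.regular.smul_mem h c) hf
    have : (χ m : X.regular).1 ∘ F = (t m : K) • (χ m : X.regular).1 := by
      funext x
      rw [Function.comp_apply, ← unitEval_apply, hF]
      rfl
    rw [this]
    exact X.regular.smul_mem (χ m : X.regular).2 _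
  let e : Equiv.Perm X.Point :=
    { toFun := F
      invFun := G
      left_inv := fun x => hχ.unitEval_injective <| MonoidHom.ext fun m => by
        rw [hG, hF, MonoidHom.inv_apply, inv_mul_cancel_left]
      right_inv := fun x => hχ.unitEval_injective <| MonoidHom.ext fun m => by
        rw [hF, hG, MonoidHom.inv_apply, mul_inv_cancel_left] }
  exact ⟨⟨e, reg t F hF, reg t⁻¹ G hG⟩, hF⟩

theorem Aut.ext_map {σ τ : X.Aut} (h : ∀ x, σ.map x = τ.map x) : σ = τ :=
  Subtype.ext (Equiv.ext h)

theorem Spans.isDiagonal_unique (hχ : Spans χ) {σ τ : X.Aut} {t : M →* Kˣ}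
    (hσ : IsDiagonal χ σ t) (hτ : IsDiagonal χ τ t) : σ = τ :=
  Aut.ext_map fun x => hχ.unitEval_injective <| MonoidHom.ext fun m => by rw [hσ, hτ]

theorem IsDiagonal.one : IsDiagonal χ 1 1 := fun _ _ => (one_mul _).symm

theorem IsDiagonal.mul {σ τ : X.Aut} {s t : M →* Kˣ} (hσ : IsDiagonal χ σ s)
    (hτ : IsDiagonal χ τ t) : IsDiagonal χ (σ * τ) (s * t) := fun x m => by
  rw [MonoidHom.mul_apply, mul_assoc, ← hτ, ← hσ]
  rfl

theorem Aut.map_inv_map (σ : X.Aut) (x : X.Point) : σ⁻¹.map (σ.map x) = x :=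
  σ.1.symm_apply_apply x

theorem Aut.map_map_inv (σ : X.Aut) (x : X.Point) : σ.map (σ⁻¹.map x) = x :=
  σ.1.apply_symm_apply x

theorem IsDiagonal.inv {σ : X.Aut} {s : M →* Kˣ} (hσ : IsDiagonal χ σ s) :
    IsDiagonal χ σ⁻¹ s⁻¹ := fun x m => by
  rw [MonoidHom.inv_apply, eq_inv_mul_iff_mul_eq, ← hσ, Aut.map_map_inv]

theorem IsDiagonal.eq [Nonempty X.Point] {σ : X.Aut} {s t : M →* Kˣ} (hs : IsDiagonal χ σ s)
    (ht : IsDiagonal χ σ t) : s = t := by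
  obtain ⟨x⟩ := (inferInstance : Nonempty X.Point)
  exact MonoidHom.ext fun m => mul_right_cancel ((hs x m).symm.trans (ht x m))

end AffineVariety

/-! ### Splitting off the free part of `M ⧸ L`; characters of `ℤ^s`. -/

/-- A subgroup `L` of a finitely generated commutative group has finite index in the kernel of a
homomorphism onto some `ℤ^s`. -/
theorem exists_hom_int_of_fg {M : Type*} [CommGroup M] [Group.FG M] (L : Subgroup M) :
    ∃ (s : ℕ) (π : M →* (Fin s → Multiplicative ℤ)) (e : Fin s → M), L ≤ π.ker ∧
      (∀ j, π (e j) = Pi.mulSingle j (Multiplicative.ofAdd 1)) ∧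
      (∃ N : ℕ, 0 < N ∧ ∀ m ∈ π.ker, m ^ N ∈ L) ∧
      ∃ S : Finset M, (∀ k ∈ S, k ∈ π.ker) ∧ ∀ m ∈ π.ker, ∃ k ∈ S, m / k ∈ L := by
  classical
  obtain ⟨ι, j, _, _, p, hp, n, ⟨E⟩⟩ := CommGroup.equiv_free_prod_prod_multiplicative_zmod (M ⧸ L)
  let F := (i : ι) → Multiplicative (ZMod (p i ^ n i))
  have hne : ∀ i, NeZero (p i ^ n i) := fun i => ⟨pow_ne_zero _ (hp i).ne_zero⟩
  have hfin : ∀ i, Finite (Multiplicative (ZMod (p i ^ n i))) := fun i =>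
    inferInstanceAs (Finite (ZMod (p i ^ n i)))
  have : Finite F := inferInstance
  have := Fintype.ofFinite F
  let r : Fin (Fintype.card j) ≃ j := (Fintype.equivFin j).symm
  let q : M →* (j → Multiplicative ℤ) × F := E.toMonoidHom.comp (QuotientGroup.mk' L)
  have hq : Function.Surjective q := E.surjective.comp (QuotientGroup.mk'_surjective L)
  have hqL : ∀ m, q m = 1 ↔ m ∈ L := fun m => by
    rw [← QuotientGroup.eq_one_iff]
    exact E.map_eq_one_iff
  let π : M →* (Fin (Fintype.card j) → Multiplicative ℤ) :=
    { toFun := fun m i => (q m).1 (r i)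
      map_one' := by rw [map_one]; rfl
      map_mul' := fun a b => by rw [map_mul]; rfl }
  have hπ : ∀ m, m ∈ π.ker ↔ (q m).1 = 1 := fun m => by
    rw [MonoidHom.mem_ker]
    refine ⟨fun h => funext fun i => ?_, fun h => funext fun i => congrFun h (r i)⟩
    have := congrFun h (r.symm i)
    simpa [π] using this
  -- The section `g` lifts the basis of the free part to `e` and the torsion elements to `S`; the
  -- exponent `N` is the order of the torsion part.
  choose g hg using hq
  refine ⟨Fintype.card j, π, fun i => g (Pi.mulSingle (r i) (Multiplicative.ofAdd 1), 1),
    fun m hm => ?_, fun i => ?_, ⟨Fintype.card F, Fintype.card_pos, fun m hm => ?_⟩,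
    Finset.univ.image fun b : F => g (1, b), fun k hk => ?_, fun m hm => ?_⟩
  · rw [hπ, (hqL m).2 hm]
    rfl
  · funext k
    change (q (g _)).1 (r k) = _
    rw [hg]
    simp [Pi.mulSingle_apply]
  · rw [← hqL, map_pow]
    refine Prod.ext ?_ ?_
    · rw [Prod.pow_fst, (hπ m).1 hm, one_pow]
      rfl
    · exact pow_card_eq_one
  · obtain ⟨b, -, rfl⟩ := Finset.mem_image.1 hk
    rw [hπ, hg]
  · refine ⟨_, Finset.mem_image_of_mem _ (Finset.mem_univ (q m).2), ?_⟩
    rw [← hqL, map_div, hg, div_eq_one]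
    exact Prod.ext ((hπ m).1 hm) rfl

theorem countable_quotient_of_map {G C : Type*} [Group G] [Countable C] (H : Subgroup G)
    (F : G → C) (h : ∀ a b, F a = F b → a⁻¹ * b ∈ H) : Countable (G ⧸ H) := by
  refine Function.Injective.countable (f := fun q : G ⧸ H => F q.out) fun q q' hq => ?_
  rw [← QuotientGroup.out_eq' q, ← QuotientGroup.out_eq' q']
  exact QuotientGroup.eq.2 (h _ _ hq)

/-- The character of `M` with parameters `τ` induced by `π : M → ℤ^s`. -/
def torusCharacter {K M : Type*} [Field K] [CommGroup M] {s : ℕ}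
    (π : M →* (Fin s → Multiplicative ℤ)) (τ : Fin s → Kˣ) : M →* Kˣ where
  toFun m := ∏ j, τ j ^ (π m j).toAdd
  map_one' := by simp
  map_mul' a b := by simp [zpow_add, Finset.prod_mul_distrib]

section TorusCharacter

variable {K M : Type*} [Field K] [CommGroup M] {s : ℕ} {π : M →* (Fin s → Multiplicative ℤ)}

theorem torusCharacter_mul (σ τ : Fin s → Kˣ) :
    torusCharacter π (σ * τ) = torusCharacter π σ * torusCharacter π τ := by
  ext m
  simp [torusCharacter, mul_zpow, Finset.prod_mul_distrib]

theorem torusCharacter_one : torusCharacter π (1 : Fin s → Kˣ) = 1 := by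
  ext m
  simp [torusCharacter]

theorem ker_le_ker_torusCharacter (τ : Fin s → Kˣ) : π.ker ≤ (torusCharacter π τ).ker := by
  intro m hm
  rw [MonoidHom.mem_ker] at hm ⊢
  simp [torusCharacter, hm]

variable {e : Fin s → M}

theorem torusCharacter_apply_basis
    (he : ∀ j, π (e j) = Pi.mulSingle j (Multiplicative.ofAdd 1)) (τ : Fin s → Kˣ) (j : Fin s) :
    torusCharacter π τ (e j) = τ j := by
  classical
  change ∏ k, τ k ^ (π (e j) k).toAdd = τ j
  rw [he, Finset.prod_eq_single j]
  · simp
  · intro k _ hk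
    rw [Pi.mulSingle_eq_of_ne hk]
    simp
  · simp

/-- Every `m` agrees modulo `π.ker` with a product of powers of the `e j`, so a character trivial on
`π.ker` is fixed by its values there. -/
theorem eq_torusCharacter
    (he : ∀ j, π (e j) = Pi.mulSingle j (Multiplicative.ofAdd 1))
    {t : M →* Kˣ} (ht : π.ker ≤ t.ker) :
    t = torusCharacter π fun j => t (e j) := by
  classical
  ext m
  have hm : m / ∏ j, e j ^ (π m j).toAdd ∈ π.ker := by
    rw [MonoidHom.mem_ker, map_div, div_eq_one, map_prod]
    funext k
    rw [Finset.prod_apply, Finset.prod_eq_single k]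
    · rw [map_zpow, he, Pi.pow_apply, Pi.mulSingle_eq_same, ← ofAdd_zsmul]
      simp
    · intro j _ hj
      rw [map_zpow, he, Pi.pow_apply, Pi.mulSingle_eq_of_ne hj.symm, one_zpow]
    · simp
  have h := ht hm
  rw [MonoidHom.mem_ker, map_div, div_eq_one, map_prod] at h
  rw [h]
  simp [torusCharacter]

end TorusCharacter

/-! ### Families of diagonal automorphisms, and automorphisms modulo diagonal ones. -/

namespace AffineVariety

variable {K : Type u} [Field K]

theorem isRegularMap_torus {B : AffineVariety K} {s : ℕ} {g : B.Point → Fin s → Kˣ}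
    (h : ∀ i, (fun b => (g b i : K)) ∈ B.regular)
    (h' : ∀ i, (fun b => ((g b i)⁻¹ : Kˣ).val) ∈ B.regular) : IsRegularMap B (torus K s) g := by
  have : torusRegular K s ≤ B.regular.comap (pullback g) := by
    refine Algebra.adjoin_le ?_
    rintro _ (⟨i, rfl⟩ | ⟨i, rfl⟩)
    · exact h i
    · exact h' i
  exact fun f hf => this hf

theorem coord_mem_torusRegular {s : ℕ} (i : Fin s) :
    (fun t : Fin s → Kˣ => (t i : K)) ∈ torusRegular K s :=
  Algebra.subset_adjoin (Or.inl ⟨i, rfl⟩)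

theorem coord_inv_mem_torusRegular {s : ℕ} (i : Fin s) :
    (fun t : Fin s → Kˣ => ((t i)⁻¹ : Kˣ).val) ∈ torusRegular K s :=
  Algebra.subset_adjoin (Or.inr ⟨i, rfl⟩)

theorem torusCharacter_mem_torusRegular {M : Type*} [CommGroup M] {s : ℕ}
    (π : M →* (Fin s → Multiplicative ℤ)) (m : M) :
    (fun τ : Fin s → Kˣ => (torusCharacter π τ m : K)) ∈ torusRegular K s := by
  have hz : ∀ (i : Fin s) (n : ℤ), (fun τ : Fin s → Kˣ => ((τ i ^ n : Kˣ) : K)) ∈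
      torusRegular K s := by
    intro i n
    cases n with
    | ofNat n =>
      simpa [Pi.pow_def] using pow_mem (coord_mem_torusRegular (K := K) i) n
    | negSucc n =>
      simpa [Pi.pow_def] using pow_mem (coord_inv_mem_torusRegular (K := K) i) (n + 1)
  have := prod_mem (S := torusRegular K s) (t := Finset.univ) fun i _ => hz i (π m i).toAdd
  convert this using 1
  funext τ
  simp [torusCharacter]

section Diagonal

variable {X : AffineVariety K} {M : Type*} [CommGroup M] {χ : M →* X.regularˣ}

theorem Spans.isRegularMap_of_isDiagonal (hχ : Spans χ) {B : AffineVariety K}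
    {φ : B.Point → X.Aut} {c : B.Point → M →* Kˣ} (hφ : ∀ b, IsDiagonal χ (φ b) (c b))
    (hc : ∀ m, (fun b => (c b m : K)) ∈ B.regular) :
    IsRegularMap (B.prod X) X (fun p => (φ p.1).map p.2) := by
  intro f hf
  refine hχ.regular_induction (p := fun f => f ∘ (fun p : B.Point × X.Point =>
    (φ p.1).map p.2) ∈ (B.prod X).regular) (fun m => ?_) (zero_mem _)
    (fun _ _ => add_mem) (fun c _ h => (B.prod X).regular.smul_mem h c) hf
  have h := mul_mem (isRegularMap_fst B X _ (hc m)) (isRegularMap_snd B X _ (χ m : X.regular).2)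
  refine Eq.mp (congrArg (· ∈ (B.prod X).regular) (funext fun p => ?_)) h
  exact (congrArg Units.val (hφ p.1 p.2 m)).symm

theorem Spans.isFamily_of_isDiagonal (hχ : Spans χ) {B : AffineVariety K}
    {φ : B.Point → X.Aut} {c : B.Point → M →* Kˣ} (hφ : ∀ b, IsDiagonal χ (φ b) (c b))
    (hc : ∀ m, (fun b => (c b m : K)) ∈ B.regular) : IsFamily B φ := by
  refine ⟨hχ.isRegularMap_of_isDiagonal hφ hc,
    hχ.isRegularMap_of_isDiagonal (fun b => (hφ b).inv) fun m => ?_⟩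
  simpa using hc m⁻¹

/-- The scalars can be read off at `x₀` as ratios of values, which makes them multiplicative in `m`.
-/
theorem isDiagonal_of_proportional {σ : X.Aut} (x₀ : X.Point)
    (h : ∀ m, ∃ c : K, ∀ x, (χ m : X.regular).1 (σ.map x) = c * (χ m : X.regular).1 x) :
    IsDiagonal χ σ (unitEval χ (σ.map x₀) * (unitEval χ x₀)⁻¹) := by
  intro x m
  obtain ⟨c, hc⟩ := h m
  refine Units.ext ?_
  simp only [MonoidHom.mul_apply, MonoidHom.inv_apply, Units.val_mul, Units.val_inv_eq_inv_val,
    unitEval_apply, hc]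
  field_simp [units_apply_ne_zero]

/-- The diagonal automorphisms of `X`. -/
def diagonalSubgroup (χ : M →* X.regularˣ) : Subgroup X.Aut where
  carrier := {σ | ∃ t, IsDiagonal χ σ t}
  one_mem' := ⟨1, IsDiagonal.one⟩
  mul_mem' := fun ⟨s, hs⟩ ⟨t, ht⟩ => ⟨s * t, hs.mul ht⟩
  inv_mem' := fun ⟨t, ht⟩ => ⟨t⁻¹, ht.inv⟩

theorem countable_quotient_diagonalSubgroup [IsAlgClosed K] [IrreducibleSpace X.Point]
    [Group.FG M] (χ : M →* X.regularˣ) : Countable (X.Aut ⧸ diagonalSubgroup χ) := by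
  obtain ⟨x₀⟩ := (inferInstance : Nonempty X.Point)
  obtain ⟨S, hS, hSu⟩ := X.exists_countable_units
  obtain ⟨G, hG⟩ := (Group.FG.out : (⊤ : Subgroup M).FG)
  have := hS.to_subtype
  -- Pulling back by `σ⁻¹` suits left cosets: if the pullbacks of a unit by `σ⁻¹` and `τ⁻¹` are
  -- proportional, then `σ⁻¹ * τ` rescales that unit. Generators of `M` suffice.
  have key : ∀ (σ : X.Aut) (g : G), ∃ h : S, ∃ c : K, ∀ x,
      (χ g : X.regular).1 (σ⁻¹.map x) = c * (h.1 : X.regular).1 x := by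
    intro σ g
    let u : X.regularˣ := χ g
    let v : X.regularˣ := ⟨⟨_, σ⁻¹.isRegularMap _ (u : X.regular).2⟩,
      ⟨_, σ⁻¹.isRegularMap _ (↑u⁻¹ : X.regular).2⟩,
      Subtype.ext (funext fun x => congrFun (congrArg Subtype.val u.mul_inv) (σ⁻¹.map x)),
      Subtype.ext (funext fun x => congrFun (congrArg Subtype.val u.inv_mul) (σ⁻¹.map x))⟩
    obtain ⟨h, hh, c, hc⟩ := hSu v
    exact ⟨⟨h, hh⟩, c, fun x => congrFun (congrArg Subtype.val hc) x⟩
  choose F hF using key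
  refine countable_quotient_of_map _ F fun σ τ hστ => ?_
  refine ⟨_, isDiagonal_of_proportional x₀ fun m => ?_⟩
  have hm : m ∈ Subgroup.closure (G : Set M) := by rw [hG]; trivial
  induction hm using Subgroup.closure_induction with
  | mem m hm =>
    obtain ⟨c, hc⟩ := hF σ ⟨m, hm⟩
    obtain ⟨c', hc'⟩ := hF τ ⟨m, hm⟩
    rw [← hστ] at hc'
    have h0 : c' ≠ 0 := by
      rintro rfl
      exact units_apply_ne_zero (χ m) _ ((hc' x₀).trans (zero_mul _))
    refine ⟨c / c', fun x => ?_⟩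
    have h1 := hc (τ.map x)
    have h2 := hc' (τ.map x)
    rw [Aut.map_inv_map] at h2
    rw [show (σ⁻¹ * τ).map x = σ⁻¹.map (τ.map x) from rfl, h1, h2]
    field_simp
  | one => exact ⟨1, fun x => by rw [map_one, one_mul]; rfl⟩
  | mul a b _ _ iha ihb =>
    obtain ⟨c, hc⟩ := iha
    obtain ⟨d, hd⟩ := ihb
    refine ⟨c * d, fun x => ?_⟩
    rw [map_mul]
    change (χ a : X.regular).1 _ * (χ b : X.regular).1 _ =
      _ * ((χ a : X.regular).1 _ * (χ b : X.regular).1 _)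
    rw [hc, hd]
    ring
  | inv a _ iha =>
    obtain ⟨c, hc⟩ := iha
    have hinv : ∀ x, (χ a⁻¹ : X.regular).1 x = ((χ a : X.regular).1 x)⁻¹ := fun x => by
      rw [← unitEval_apply, map_inv, Units.val_inv_eq_inv_val, unitEval_apply]
    exact ⟨c⁻¹, fun x => by rw [hinv, hinv, hc, mul_inv]⟩

end Diagonal

/-! ### Open sets of `Aut(X)` and the neutral component. -/

/-- A union of left cosets of `N` pulls back under a family to a set that contains every irreducible
component it meets. Its complement is a finite union of components, hence closed. -/
theorem isOpen_of_irreducible_families {X : AffineVariety K} (N : Subgroup X.Aut)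
    (hN : ∀ (B : AffineVariety K) (φ : B.Point → X.Aut), IsFamily B φ → ∀ Z : Set B.Point,
      IsIrreducible Z → ∀ b₀ ∈ Z, ∀ b ∈ Z, (φ b₀)⁻¹ * φ b ∈ N)
    {U : Set X.Aut} (hU : ∀ σ ∈ U, ∀ n ∈ N, σ * n ∈ U) : IsOpen U := by
  refine isOpen_iff_forall_family.2 fun B φ hφ => ?_
  have hfin : (irreducibleComponents B.Point).Finite :=
    TopologicalSpace.NoetherianSpace.finite_irreducibleComponents
  have h : (φ ⁻¹' U)ᶜ = ⋃₀ {Z ∈ irreducibleComponents B.Point | Z ⊆ (φ ⁻¹' U)ᶜ} := by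
    refine subset_antisymm (fun b hb => ⟨irreducibleComponent b,
      ⟨irreducibleComponent_mem_irreducibleComponents b, fun b' hb' hU' => hb ?_⟩,
      mem_irreducibleComponent⟩) (Set.sUnion_subset fun Z hZ => hZ.2)
    have := hU _ hU' _ (hN B φ hφ _ isIrreducible_irreducibleComponent b' hb' b
      mem_irreducibleComponent)
    rwa [mul_inv_cancel_left] at this
  rw [← isClosed_compl_iff, h, Set.sUnion_eq_biUnion]
  exact (hfin.subset (Set.sep_subset _ _)).isClosed_biUnion fun Z hZ =>
    isClosed_of_mem_irreducibleComponents Z hZ.1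

/-- A subgroup which is the image of an irreducible family and contains the differences of all
irreducible families is the neutral component. -/
theorem neutralComponent_eq {X T : AffineVariety K} [IrreducibleSpace T.Point]
    (N : Subgroup X.Aut)
    (hN : ∀ (B : AffineVariety K) (φ : B.Point → X.Aut), IsFamily B φ → ∀ Z : Set B.Point,
      IsIrreducible Z → ∀ b₀ ∈ Z, ∀ b ∈ Z, (φ b₀)⁻¹ * φ b ∈ N)
    {θ : T.Point → X.Aut} (hθ : IsFamily T θ) (hr : Set.range θ = N) :
    X.neutralComponent = N := by
  refine le_antisymm ?_ ?_
  -- `N` and its complement are unions of left cosets, so `N` is clopen. The reverse inclusion holds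
  -- because `N` is a continuous image of an irreducible space.
  · have ho : IsOpen (N : Set X.Aut) :=
      isOpen_of_irreducible_families N hN fun σ hσ n hn => N.mul_mem hσ hn
    have hc : IsOpen ((N : Set X.Aut)ᶜ) :=
      isOpen_of_irreducible_families N hN fun σ hσ n hn h => hσ ((N.mul_mem_cancel_right hn).1 h)
    exact (IsClopen.connectedComponent_subset ⟨⟨hc⟩, ho⟩ N.one_mem :
      connectedComponent (1 : X.Aut) ⊆ N)
  · have hcont : Continuous θ := ⟨fun U hU => isOpen_iff_forall_family.1 hU T θ hθ⟩
    have h := (isPreconnected_range hcont).subset_connectedComponent (x := 1)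
      (hr ▸ N.one_mem)
    rw [hr] at h
    exact h

end AffineVariety

/-! ### The torus acting on a toral variety. -/

namespace AffineVariety

variable {K : Type u} [Field K]

/-- The restricted coordinates and their inverses generate `K[X]` as an algebra. The group they
generate is closed under products, so it already spans linearly. -/
theorem IsToral.exists_spans {X : AffineVariety K} (hX : X.IsToral) :
    ∃ (M : Type u) (_ : CommGroup M) (_ : Group.FG M) (χ : M →* X.regularˣ), Spans χ := by
  obtain ⟨-, d, Z, hZ, e, he, he'⟩ := hX
  have hreg : ∀ f ∈ torusRegular K d, (fun x => f (e x).1) ∈ X.regular := fun f hf =>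
    he _ ⟨f, hf, rfl⟩
  let u : Fin d → X.regularˣ := fun i =>
    ⟨⟨_, hreg _ (coord_mem_torusRegular i)⟩, ⟨_, hreg _ (coord_inv_mem_torusRegular i)⟩,
      Subtype.ext (funext fun x => Units.mul_inv ((e x).1 i)),
      Subtype.ext (funext fun x => Units.inv_mul ((e x).1 i))⟩
  let M := Subgroup.closure (Set.range u)
  have hM : Group.FG M := Group.closure_finite_fg _
  refine ⟨M, inferInstance, hM, M.subtype, ?_⟩
  let R : Subalgebra K X.regular := Algebra.adjoin K (Set.range fun m : M => (m.1 : X.regular))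
  have hR : Subalgebra.toSubmodule R =
      Submodule.span K (Set.range fun m : M => (m.1 : X.regular)) := by
    rw [Algebra.adjoin_eq_span]
    congr 1
    exact congrArg _ (Submonoid.closure_eq (MonoidHom.mrange
      ((Units.coeHom X.regular).comp M.subtype)))
  have hle : torusRegular K d ≤ (R.map X.regular.val).comap (pullback fun x => (e x).1) := by
    refine Algebra.adjoin_le ?_
    have hu : ∀ i, u i ∈ M := fun i => Subgroup.subset_closure ⟨i, rfl⟩
    rintro _ (⟨i, rfl⟩ | ⟨i, rfl⟩)
    · exact ⟨(u i : X.regular), Algebra.subset_adjoin ⟨⟨u i, hu i⟩, rfl⟩, rfl⟩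
    · exact ⟨(↑(u i)⁻¹ : X.regular), Algebra.subset_adjoin ⟨⟨(u i)⁻¹, M.inv_mem (hu i)⟩, rfl⟩,
        rfl⟩
  change Submodule.span K (Set.range fun m : M => (m.1 : X.regular)) = ⊤
  rw [← hR, eq_top_iff]
  rintro ⟨f, hf⟩ -
  obtain ⟨g, hg, hgf⟩ := he' f hf
  obtain ⟨r, hr, hrg⟩ := hle hg
  have : r = ⟨f, hf⟩ := Subtype.ext (hrg.trans (funext fun x => by
    have := congrFun hgf (e x)
    change g (e x).1 = f (e.symm (e x)) at this
    rw [Equiv.symm_apply_apply] at this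
    exact this))
  exact this ▸ hr

section Structure

variable {X : AffineVariety K} {M : Type*} [CommGroup M] {χ : M →* X.regularˣ} {s : ℕ}
  {π : M →* (Fin s → Multiplicative ℤ)}

/-- The action of the torus `(Kˣ)^s` on `X` through diagonal automorphisms. -/
noncomputable def torusAction (hχ : Spans χ) (hL : circuitSubgroup (unitRelations χ) ≤ π.ker) :
    (Fin s → Kˣ) →* X.Aut :=
  have h := fun τ : Fin s → Kˣ => (hχ.exists_isDiagonal
    (hL.trans (ker_le_ker_torusCharacter τ))).choose_spec
  { toFun := fun τ => (hχ.exists_isDiagonal (hL.trans (ker_le_ker_torusCharacter τ))).choose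
    map_one' := hχ.isDiagonal_unique (h 1) (torusCharacter_one (K := K) (π := π) ▸ IsDiagonal.one)
    map_mul' := fun σ τ => hχ.isDiagonal_unique (h (σ * τ))
      (torusCharacter_mul (π := π) σ τ ▸ (h σ).mul (h τ)) }

variable (hχ : Spans χ) (hL : circuitSubgroup (unitRelations χ) ≤ π.ker)

theorem isDiagonal_torusAction (τ : Fin s → Kˣ) :
    IsDiagonal χ (torusAction hχ hL τ) (torusCharacter π τ) :=
  (hχ.exists_isDiagonal (hL.trans (ker_le_ker_torusCharacter τ))).choose_spec

theorem isFamily_torusAction : IsFamily (torus K s) (torusAction hχ hL) :=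
  hχ.isFamily_of_isDiagonal (isDiagonal_torusAction hχ hL) (torusCharacter_mem_torusRegular π)

variable {e : Fin s → M}

theorem torusAction_apply_basis (he : ∀ j, π (e j) = Pi.mulSingle j (Multiplicative.ofAdd 1))
    (τ : Fin s → Kˣ) (x : X.Point) (j : Fin s) :
    unitEval χ ((torusAction hχ hL τ).map x) (e j) = τ j * unitEval χ x (e j) := by
  rw [isDiagonal_torusAction hχ hL, torusCharacter_apply_basis he]

theorem torusAction_injective (he : ∀ j, π (e j) = Pi.mulSingle j (Multiplicative.ofAdd 1))
    [Nonempty X.Point] : Function.Injective (torusAction hχ hL) := by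
  obtain ⟨x⟩ := (inferInstance : Nonempty X.Point)
  intro σ τ h
  funext j
  have h1 := torusAction_apply_basis hχ hL he σ x j
  rw [h, torusAction_apply_basis hχ hL he] at h1
  exact (mul_right_cancel h1).symm

theorem mem_range_torusAction (he : ∀ j, π (e j) = Pi.mulSingle j (Multiplicative.ofAdd 1))
    {σ : X.Aut} {t : M →* Kˣ} (hσ : IsDiagonal χ σ t) (ht : π.ker ≤ t.ker) :
    σ ∈ (torusAction hχ hL).range :=
  ⟨_, hχ.isDiagonal_unique (isDiagonal_torusAction hχ hL _) (eq_torusCharacter he ht ▸ hσ)⟩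

/-- Rigidity of units makes the translated family diagonal on `Z`. What remains is that its
characters are trivial on `π.ker`, not only on the circuit subgroup. -/
theorem inv_mul_mem_range_torusAction [IsAlgClosed K] [IrreducibleSpace X.Point]
    (he : ∀ j, π (e j) = Pi.mulSingle j (Multiplicative.ofAdd 1))
    {n : ℕ} (hn : 0 < n) (hker : ∀ m ∈ π.ker, m ^ n ∈ circuitSubgroup (unitRelations χ))
    (B : AffineVariety K) (φ : B.Point → X.Aut) (hφ : IsFamily B φ) (Z : Set B.Point)
    (hZ : IsIrreducible Z) (b₀ : B.Point) (hb₀ : b₀ ∈ Z) (b : B.Point) (hb : b ∈ Z) :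
    (φ b₀)⁻¹ * φ b ∈ (torusAction hχ hL).range := by
  classical
  obtain ⟨x₀⟩ := (inferInstance : Nonempty X.Point)
  have hψ := hφ.mul_left (φ b₀)⁻¹
  let t : B.Point → M →* Kˣ := fun b =>
    unitEval χ (((φ b₀)⁻¹ * φ b).map x₀) * (unitEval χ x₀)⁻¹
  have hdiag : ∀ b ∈ Z, IsDiagonal χ ((φ b₀)⁻¹ * φ b) (t b) := by
    intro b hb
    refine isDiagonal_of_proportional x₀ fun m => ?_
    obtain ⟨c, hc⟩ := hψ.unit_comp_eq hZ hb₀ hb (χ m)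
    refine ⟨c, fun x => ?_⟩
    rw [hc, inv_mul_cancel]
    rfl
  refine mem_range_torusAction hχ hL he (hdiag b hb) fun m hm => ?_
  have hreg : (fun b => (t b m : K)) ∈ B.regular :=
    mul_mem (hψ.orbit x₀ _ (χ m : X.regular).2)
      (B.regular.algebraMap_mem (((unitEval χ x₀)⁻¹ m : Kˣ) : K))
  -- On `Z` the regular function `b ↦ t b m` takes values in the `n`-th roots of unity. Being
  -- finite-valued on an irreducible set it is constant, equal to its value 1 at `b₀`.
  obtain ⟨_, hD, hZD⟩ := (isIrreducible_iff_sUnion_isClosed.1 hZ)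
    ((Polynomial.nthRootsFinset n (1 : K)).image fun z => {b | (t b m : K) - z = 0})
    (fun D hD => by
      obtain ⟨z, -, rfl⟩ := Finset.mem_image.1 hD
      exact B.isClosed_zeroLocus (sub_mem hreg (B.regular.algebraMap_mem z)))
    (fun b hb => by
      refine ⟨_, Finset.mem_coe.2 (Finset.mem_image_of_mem _ (a := (t b m : K)) ?_), sub_self _⟩
      rw [Polynomial.mem_nthRootsFinset hn, ← Units.val_pow_eq_pow_val, ← map_pow]
      exact congrArg Units.val ((hdiag b hb).circuitSubgroup_le (hker m hm)))
  obtain ⟨z, -, rfl⟩ := Finset.mem_image.1 hD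
  have h₀ : t b₀ m = 1 := by
    simp only [t, inv_mul_cancel]
    exact mul_inv_cancel (unitEval χ x₀ m)
  refine Units.ext ((sub_eq_zero.1 (hZD hb)).trans ?_)
  rw [← sub_eq_zero.1 (hZD hb₀), h₀]

theorem isTorusOfRank_range_torusAction [Nonempty X.Point]
    (he : ∀ j, π (e j) = Pi.mulSingle j (Multiplicative.ofAdd 1)) :
    IsTorusOfRank (torusAction hχ hL).range s := by
  refine ⟨MonoidHom.ofInjective (torusAction_injective hχ hL he), isFamily_torusAction hχ hL,
    fun B φ hφ => ?_⟩
  obtain ⟨x₀⟩ := (inferInstance : Nonempty X.Point)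
  let ρ := MonoidHom.ofInjective (torusAction_injective hχ hL he)
  -- The torus coordinates are recovered from the orbit of one point, hence depend regularly on `b`.
  have hρ : ∀ b j, ρ.symm (φ b) j =
      unitEval χ ((φ b : X.Aut).map x₀) (e j) * (unitEval χ x₀ (e j))⁻¹ := by
    intro b j
    have h := torusAction_apply_basis hχ hL he (ρ.symm (φ b)) x₀ j
    rw [show torusAction hχ hL (ρ.symm (φ b)) = φ b from
      congrArg Subtype.val (ρ.apply_symm_apply (φ b))] at h
    rw [h, mul_inv_cancel_right]
  refine isRegularMap_torus (fun j => ?_) fun j => ?_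
  · change (fun b => (ρ.symm (φ b) j : K)) ∈ B.regular
    simp only [hρ]
    exact mul_mem (hφ.orbit x₀ _ (χ (e j) : X.regular).2) (B.regular.algebraMap_mem _)
  · change (fun b => ((ρ.symm (φ b) j)⁻¹ : Kˣ).val) ∈ B.regular
    simp only [hρ, mul_inv, ← map_inv, Units.val_mul]
    exact mul_mem (hφ.orbit x₀ _ (χ (e j)⁻¹ : X.regular).2) (B.regular.algebraMap_mem _)

include hχ hL in
-- The subtori with first `k` coordinates equal to 1 have irreducible orbits of `x₀`, strictly
-- decreasing in `k`. Their vanishing ideals are `s + 1` primes in a strict chain.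
theorem rank_le_dim [Infinite K] [IrreducibleSpace X.Point]
    (he : ∀ j, π (e j) = Pi.mulSingle j (Multiplicative.ofAdd 1)) :
    (s : WithBot ℕ∞) ≤ X.dim := by
  obtain ⟨x₀⟩ := (inferInstance : Nonempty X.Point)
  have := (torus K s).isDomain_regular
  let ι : ℕ → (Fin s → Kˣ) → Fin s → Kˣ := fun k τ i => if i.1 < k then 1 else τ i
  have hι : ∀ k, IsRegularMap (torus K s) (torus K s) (ι k) := by
    intro k
    refine isRegularMap_torus (fun i => ?_) fun i => ?_
    · by_cases h : i.1 < k
      · simp only [ι, h, if_true]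
        exact one_mem _
      · simp only [ι, h, if_false]
        exact coord_mem_torusRegular i
    · by_cases h : i.1 < k
      · simp only [ι, h, if_true, inv_one]
        exact one_mem _
      · simp only [ι, h, if_false]
        exact coord_inv_mem_torusRegular i
  have horb := (isFamily_torusAction hχ hL).orbit x₀
  let r : ℕ → X.regular →ₐ[K] (torus K s).regular := fun k =>
    ((pullback fun τ => (torusAction hχ hL (ι k τ)).map x₀).comp X.regular.val).codRestrict _
      fun f => horb.comp (hι k) f.1 f.2
  have hr : ∀ k (f : X.regular), r k f = 0 ↔
      ∀ τ, f.1 ((torusAction hχ hL (ι k τ)).map x₀) = 0 := fun k f =>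
    ⟨fun h τ => congrFun (congrArg Subtype.val h) τ, fun h => Subtype.ext (funext h)⟩
  let P : Fin (s + 1) → PrimeSpectrum X.regular := fun k =>
    ⟨RingHom.ker (r k).toRingHom, RingHom.ker_isPrime _⟩
  have hmem : ∀ k (f : X.regular), f ∈ (P k).asIdeal ↔ r k f = 0 := fun k f => Iff.rfl
  have hP : StrictMono P := by
    refine Fin.strictMono_iff_lt_succ.2 fun k => lt_of_le_not_ge ?_ fun hle => ?_
    · intro f hf
      rw [hmem, hr] at hf ⊢
      intro τ
      have hc : ι k.castSucc.1 (ι k.succ.1 τ) = ι k.succ.1 τ := by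
        funext i
        simp only [ι, Fin.val_succ, Fin.val_castSucc]
        split_ifs <;> first | rfl | omega
      exact hc ▸ hf (ι k.succ.1 τ)
    · let c : K := (χ (e k) : X.regular).1 x₀
      -- This function vanishes on the orbit where coordinate `k` is 1, but on the larger orbit it
      -- takes the value `(a - 1) * c`, nonzero for `a` different from 0 and 1.
      let f : X.regular := (χ (e k) : X.regular) - algebraMap K _ c
      have hf : ∀ (n : ℕ) τ, f.1 ((torusAction hχ hL (ι n τ)).map x₀) = (ι n τ k - 1) * c := by
        intro n τ
        have := congrArg Units.val (torusAction_apply_basis hχ hL he (ι n τ) x₀ k)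
        rw [unitEval_apply] at this
        change (χ (e k) : X.regular).1 _ - c = _
        rw [this, Units.val_mul, unitEval_apply]
        ring
      have h1 : f ∈ (P k.succ).asIdeal := by
        rw [hmem, hr]
        intro τ
        rw [hf]
        simp [ι]
      have h2 := hle h1
      rw [hmem, hr] at h2
      classical
      obtain ⟨a, ha⟩ := Infinite.exists_notMem_finset ({0, 1} : Finset K)
      simp only [Finset.mem_insert, Finset.mem_singleton, not_or] at ha
      have h3 := h2 fun _ => Units.mk0 a ha.1
      rw [hf] at h3
      have h4 := (mul_eq_zero.1 h3).resolve_right (units_apply_ne_zero _ _)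
      simp only [ι, Fin.val_castSucc, lt_irrefl, if_false, Units.val_mk0] at h4
      exact ha.2 (sub_eq_zero.1 h4)
  exact Order.LTSeries.length_le_krullDim (LTSeries.mk s P hP)

/-- Modulo the torus, a diagonal automorphism is determined by the values of its character on the
finite set `S`, which are `n`-th roots of unity. This combines with the countability of
automorphisms modulo diagonal ones. -/
theorem countable_quotient_range_torusAction [IsAlgClosed K] [IrreducibleSpace X.Point]
    [Group.FG M] (he : ∀ j, π (e j) = Pi.mulSingle j (Multiplicative.ofAdd 1))
    {n : ℕ} (hn : 0 < n) (hker : ∀ m ∈ π.ker, m ^ n ∈ circuitSubgroup (unitRelations χ))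
    {S : Finset M} (hS : ∀ k ∈ S, k ∈ π.ker)
    (hS' : ∀ m ∈ π.ker, ∃ k ∈ S, m / k ∈ circuitSubgroup (unitRelations χ)) :
    Countable (X.Aut ⧸ (torusAction hχ hL).range) := by
  classical
  have hle : (torusAction hχ hL).range ≤ diagonalSubgroup χ := by
    rintro _ ⟨τ, rfl⟩
    exact ⟨_, isDiagonal_torusAction hχ hL τ⟩
  have h1 := countable_quotient_diagonalSubgroup χ
  choose t ht using fun σ : diagonalSubgroup χ => σ.2
  have h2 : Countable (diagonalSubgroup χ ⧸
      (torusAction hχ hL).range.subgroupOf (diagonalSubgroup χ)) := by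
    refine countable_quotient_of_map (C := S → Polynomial.nthRootsFinset n (1 : K)) _
      (fun σ k => ⟨t σ k, ?_⟩) fun σ τ hστ => ?_
    · rw [Polynomial.mem_nthRootsFinset hn, ← Units.val_pow_eq_pow_val, ← map_pow]
      exact congrArg Units.val ((ht σ).circuitSubgroup_le (hker k (hS k k.2)))
    · have hd := (ht σ).inv.mul (ht τ)
      refine mem_range_torusAction hχ hL he hd fun m hm => ?_
      obtain ⟨k, hk, hmk⟩ := hS' m hm
      have e1 := hd.circuitSubgroup_le hmk
      rw [MonoidHom.mem_ker, map_div, div_eq_one] at e1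
      have e2 : t σ k = t τ k := Units.ext (congrArg Subtype.val (congrFun hστ ⟨k, hk⟩))
      rw [MonoidHom.mem_ker, e1, MonoidHom.mul_apply, MonoidHom.inv_apply, e2, inv_mul_cancel]
  exact (Subgroup.quotientEquivProdOfLE hle).injective.countable

end Structure

end AffineVariety

theorem mainTheorem8 {K : Type u} [Field K] [IsAlgClosed K] [CharZero K] [Uncountable K]
    (X : AffineVariety K) (hX : X.IsToral) :
    (∃ s : ℕ, AffineVariety.IsTorusOfRank X.neutralComponent s ∧ (s : WithBot ℕ∞) ≤ X.dim) ∧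
      DiscreteTopology (X.Aut ⧸ X.neutralComponent) ∧
      Countable (X.Aut ⧸ X.neutralComponent) := by
  have := hX.1
  obtain ⟨M, _, _, χ, hχ⟩ := hX.exists_spans
  obtain ⟨s, π, e, hL, he, ⟨n, hn, hker⟩, S, hS, hS'⟩ :=
    exists_hom_int_of_fg (circuitSubgroup (AffineVariety.unitRelations χ))
  have hN := AffineVariety.inv_mul_mem_range_torusAction hχ hL he hn hker
  rw [AffineVariety.neutralComponent_eq _ hN (AffineVariety.isFamily_torusAction hχ hL) rfl]
  refine ⟨⟨s, AffineVariety.isTorusOfRank_range_torusAction hχ hL he,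
    AffineVariety.rank_le_dim hχ hL he⟩, ?_,
    AffineVariety.countable_quotient_range_torusAction hχ hL he hn hker hS hS'⟩
  -- The preimage in `Aut(X)` of any subset of the quotient is a union of cosets, hence open.
  refine discreteTopology_iff_forall_isOpen.2 fun U => isOpen_coinduced.2 ?_
  refine AffineVariety.isOpen_of_irreducible_families _ hN fun σ hσ m hm => ?_
  have : (QuotientGroup.mk (σ * m) : X.Aut ⧸ (AffineVariety.torusAction hχ hL).range) =
      QuotientGroup.mk σ := QuotientGroup.mk_mul_of_mem σ hm
  change QuotientGroup.mk (σ * m) ∈ U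
  rw [this]
  exact hσ
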